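/- Fix an integer $r\ge 1$. All rings are commutative and unital. **Ground rings.** A ground ring is a ring $S$ with parameters $\rho$, $q$, $\delta_j$ ($j\ge 0$), $u_1,\dots,u_r$ in $S$ such that $\rho,q,\delta_0,u_1,\dots,u_r$ are invertible and $\rho^{-1}-\rho=(q^{-1}-q)(\delta_0-1)$. A unital ring homomorphism $\varphi:S\to S'$ between ground rings is a *morphism of ground rings* if $\varphi(\delta_j)=\delta_j'$ for all $j$, $\varphi(u_i)=u_i'$ for all $i$, and either $\varphi(\rho)=\rho'$ and $\varphi(q)\in\{q',-q'^{-1}\}$, or $\varphi(\rho)=-\rho'$ and $\varphi(q)\in\{-q',q'^{-1}\}$. **Admissibility.** Put $a_j=(-1)^{r-j}\varepsilon_{r-j}(u_1,\dots,u_r)$, where $\varepsilon_k$ is the $k$-th elementary symmetric polynomial. The ground ring $S$ is *admissible* if $q-q^{-1}$ is non-zero and not a zero-divisor, and $$\rho\Big(a_\ell-\frac{a_{r-\ell}}{a_0}\Big)+(q-q^{-1})\Big[\sum_{j=1}^{r-\ell}a_{j+\ell}\delta_j-\sum_{j=\max(\ell+1,\lceil r/2\rceil)}^{\lfloor(\ell+r)/2\rfloor}a_{2j-\ell}+\sum_{j=\lceil\ell/2\rceil}^{\min(\ell,\lceil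 r/2\rceil-1)}a_{2j-\ell}\Big]=0\quad(1\le\ell\le r-1),$$ $$\rho^{-1}a_0-\rho a_0^{-1}=\begin{cases}0&r\text{ odd}\\ q-q^{-1}&r\text{ even,}\end{cases}\qquad \delta_n=-\sum_{j=0}^{r-1}a_j\delta_{n-r+j}\quad(n\ge r).$$ **$u$-admissibility.** If $S$ is an integral domain, it is *$u$-admissible* if $q-q^{-1}\neq0$, the $u_i$ are distinct, $u_iu_j\ne1$ for all $i,j$ (including $i=j$), and $\delta_n=\sum_{j=1}^r\gamma_ju_j^n$ for all $n\ge0$, where, in the field of fractions of $S$, $$\gamma_j=\prod_{\ell\ne j}\frac{u_\ell u_j-1}{u_j-u_\ell}\left(\frac{1-u_j^2}{\rho(q^{-1}-q)}\prod_{\ell\neq j}u_\ell+\begin{cases}1&r\text{ odd}\\-u_j&r\text{ even}\end{cases}\right).$$ **The universal $u$-admissible ring.** In the field of rational functions $\mathbb Q(\boldsymbol q,\boldsymbol u_1,\dots,\boldsymbol u_r)$ let $\boldsymbol\rho=\prod_j\boldsymbol u_j$ if $r$ is odd and $\boldsymbol\rho=\boldsymbol q^{-1}\prod_j\boldsymbol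 u_j$ if $r$ is even, define $\boldsymbol\gamma_j$ by the formula above, and put $\boldsymbol\delta_n=\sum_j\boldsymbol\gamma_j\boldsymbol u_j^n$ for $n\ge 0$. The universal $u$-admissible ring is the subring $\overline S=\mathbb Z[\boldsymbol q^{\pm1},\boldsymbol u_1^{\pm1},\dots,\boldsymbol u_r^{\pm1},(\boldsymbol q^{-1}-\boldsymbol q)^{-1},\boldsymbol\delta_0^{-1}]$. **Theorem.** The elements $\boldsymbol\rho,\boldsymbol q,\boldsymbol\delta_n$ ($n\ge 0$), $\boldsymbol u_1,\dots,\boldsymbol u_r$ are $u$-admissible ground ring parameters in $\overline S$, and there exist an admissible ring $\overline R_0$ and an admissible integral domain $\overline R_+$, with parameters $\bar\rho,\bar q,\bar\delta_j,\bar u_i$, such that: 1. There is a morphism of ground rings $\pi:\overline R_0\to\overline R_+$. 2. $\overline R_0$ and $\overline R_+$ are each generated as unital rings by $\bar q^{\pm1},\bar\rho^{\pm1},\bar\delta_0^{\pm1},\bar\delta_1,\dots,\bar\delta_{r-1},\bar u_1^{\pm1},\dots,\bar u_r^{\pm1}$. 3. The parameters $\bar q,\bar u_1,\dots,\bar u_r$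 of $\overline R_+$, and likewise those of $\overline R_0$, are algebraically independent over $\mathbb Z$. 4. For every admissible ring $S$ there is a morphism of ground rings $\overline R_0\to S$. If $S$ is also an integral domain, there are morphisms of ground rings $\varphi:\overline R_0\to S$ and $\psi:\overline R_+\to S$ with $\varphi=\psi\circ\pi$. 5. $\overline R_+[(\bar q-\bar q^{-1})^{-1}]$, with the images of the parameters of $\overline R_+$, is isomorphic to $\overline S$ by an isomorphism of ground rings. -/

import Mathlib

universe v w

/-- A ground ring: a commutative unital ring `S` with parameters `ρ`, `q`, `δ j` (`j ≥ 0`) and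
`u 1, …, u r` such that `ρ`, `q`, `δ 0` and all `u i` are invertible and
`ρ⁻¹ - ρ = (q⁻¹ - q) (δ 0 - 1)`. A term of `GroundRing r S` is a choice of such parameters in `S`. -/
structure GroundRing (r : ℕ) (S : Type v) [CommRing S] where
  ρ : Sˣ
  q : Sˣ
  δ : ℕ → S
  u : Fin r → Sˣ
  isUnit_δ_zero : IsUnit (δ 0)
  rel : (↑ρ⁻¹ : S) - ↑ρ = ((↑q⁻¹ : S) - ↑q) * (δ 0 - 1)

namespace GroundRing

variable {r : ℕ} {S : Type v} [CommRing S] {T : Type w} [CommRing T]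

/-- The signed elementary symmetric function `a j = (-1)^(r-j) ε_{r-j}(u 1, …, u r)`,
used for `0 ≤ j ≤ r`. -/
def a (P : GroundRing r S) (j : ℕ) : S :=
  (-1) ^ (r - j) * ∑ t ∈ Finset.powersetCard (r - j) (Finset.univ : Finset (Fin r)),
    ∏ i ∈ t, (P.u i : S)

/-- `a 0 = (-1)^r u 1 ⋯ u r` as a unit. -/
def aZero (P : GroundRing r S) : Sˣ := (-1) ^ r * ∏ i, P.u i

theorem coe_aZero (P : GroundRing r S) : (P.aZero : S) = P.a 0 := by
  have h : Finset.powersetCard r (Finset.univ : Finset (Fin r)) = {Finset.univ} := by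
    simpa using Finset.powersetCard_self (Finset.univ : Finset (Fin r))
  simp [aZero, a, h]

/-- The element `q - q⁻¹`. -/
def qDiff (P : GroundRing r S) : S := (P.q : S) - (↑P.q⁻¹ : S)

/-- Admissible parameters: `q - q⁻¹` is non-zero and not a zero-divisor, and the explicit relations
of Wilcox and Yu hold. (`(r + 1) / 2`, `(ℓ + 1) / 2` and `(ℓ + r) / 2` are `⌈r/2⌉`, `⌈ℓ/2⌉` and
`⌊(ℓ + r)/2⌋`; all natural-number subtractions below are of a smaller from a larger number.) -/
structure IsAdmissible (P : GroundRing r S) : Prop where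
  qDiff_ne_zero : P.qDiff ≠ 0
  qDiff_mem : P.qDiff ∈ nonZeroDivisors S
  rel_ell : ∀ ℓ : ℕ, 1 ≤ ℓ → ℓ ≤ r - 1 →
    (P.ρ : S) * (P.a ℓ - P.a (r - ℓ) * (↑P.aZero⁻¹ : S)) +
      P.qDiff *
        ((∑ j ∈ Finset.Icc 1 (r - ℓ), P.a (j + ℓ) * P.δ j)
          - (∑ j ∈ Finset.Icc (max (ℓ + 1) ((r + 1) / 2)) ((ℓ + r) / 2), P.a (2 * j - ℓ))
          + ∑ j ∈ Finset.Icc ((ℓ + 1) / 2) (min ℓ ((r + 1) / 2 - 1)), P.a (2 * j - ℓ)) = 0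
  rel_rho : (↑P.ρ⁻¹ : S) * P.a 0 - (P.ρ : S) * (↑P.aZero⁻¹ : S) = if Odd r then 0 else P.qDiff
  rel_delta : ∀ n : ℕ, r ≤ n → P.δ n = -∑ j ∈ Finset.range r, P.a j * P.δ (n - r + j)

/-- Morphisms of ground rings: unital ring homomorphisms that preserve all `δ j` and `u i`, and with
either `ρ ↦ ρ'` and `q ↦ q'` or `q ↦ -q'⁻¹`, or `ρ ↦ -ρ'` and `q ↦ -q'` or `q ↦ q'⁻¹`. -/
def IsMorphism (P : GroundRing r S) (P' : GroundRing r T) (φ : S →+* T) : Prop :=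
  ((φ P.ρ = P'.ρ ∧ (φ P.q = P'.q ∨ φ P.q = -(↑P'.q⁻¹ : T))) ∨
    (φ P.ρ = -(P'.ρ : T) ∧ (φ P.q = -(P'.q : T) ∨ φ P.q = (↑P'.q⁻¹ : T)))) ∧
  (∀ j, φ (P.δ j) = P'.δ j) ∧ ∀ i, φ (P.u i) = P'.u i

/-- The images of the parameters under a ring homomorphism, as parameters of the target. -/
def map (P : GroundRing r S) (f : S →+* T) : GroundRing r T where
  ρ := Units.map (f : S →* T) P.ρ
  q := Units.map (f : S →* T) P.q
  δ j := f (P.δ j)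
  u i := Units.map (f : S →* T) (P.u i)
  isUnit_δ_zero := P.isUnit_δ_zero.map f
  rel := by
    have h := congrArg f P.rel
    simp only [map_sub, map_mul, map_one] at h
    exact h

/-- The ground ring `S[(q - q⁻¹)⁻¹]`, with the images of the parameters of `S`. -/
noncomputable def localized (P : GroundRing r S) : GroundRing r (Localization.Away P.qDiff) :=
  P.map (algebraMap S (Localization.Away P.qDiff))

/-- The set `q^{±1}, ρ^{±1}, (δ 0)^{±1}, δ 1, …, δ (r-1), (u i)^{±1}`. -/
def generators (P : GroundRing r S) : Set S :=
  {(P.q : S), (↑P.q⁻¹ : S), (P.ρ : S), (↑P.ρ⁻¹ : S), (↑P.isUnit_δ_zero.unit⁻¹ : S)} ∪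
    {x | ∃ j < r, x = P.δ j} ∪
    {x | ∃ i, x = (P.u i : S) ∨ x = (↑(P.u i)⁻¹ : S)}

/-- `q, u 1, …, u r` are algebraically independent over `ℤ`. -/
def AlgIndep (P : GroundRing r S) : Prop :=
  AlgebraicIndependent ℤ (fun i : Option (Fin r) => i.elim (P.q : S) fun i => (P.u i : S))

end GroundRing

/-- The elements `γ j` of a field attached to `ρ`, `q` and `u 1, …, u r`. -/
def gammaCoeff {r : ℕ} {K : Type v} [Field K] (ρ q : K) (u : Fin r → K) (j : Fin r) : K :=
  (∏ ℓ ∈ Finset.univ.erase j, (u ℓ * u j - 1) / (u j - u ℓ)) *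
    ((1 - u j ^ 2) / (ρ * (q⁻¹ - q)) * (∏ ℓ ∈ Finset.univ.erase j, u ℓ) +
      if Odd r then 1 else -u j)

/-- `u`-admissible parameters in an integral domain; the formula for `δ n` is an equation in the
field of fractions. -/
structure GroundRing.IsUAdmissible {r : ℕ} {S : Type v} [CommRing S] [IsDomain S]
    (P : GroundRing r S) : Prop where
  qDiff_ne_zero : P.qDiff ≠ 0
  u_injective : Function.Injective P.u
  u_mul_ne_one : ∀ i j, P.u i * P.u j ≠ 1
  delta_eq : ∀ n : ℕ, algebraMap S (FractionRing S) (P.δ n) =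
    ∑ j, gammaCoeff (algebraMap S (FractionRing S) P.ρ) (algebraMap S (FractionRing S) P.q)
      (fun i => algebraMap S (FractionRing S) (P.u i)) j *
        algebraMap S (FractionRing S) (P.u j) ^ n

namespace UniversalU

/-- The field `ℚ(q, u 1, …, u r)`, as the field of fractions of `ℤ[q, u 1, …, u r]`; the
indeterminate `q` has index `none` and `u i` has index `some i`. -/
abbrev RatField (r : ℕ) : Type := FractionRing (MvPolynomial (Option (Fin r)) ℤ)

noncomputable section

/-- The indeterminate `q`. -/
def q (r : ℕ) : RatField r := algebraMap (MvPolynomial (Option (Fin r)) ℤ) _ (MvPolynomial.X none)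

/-- The indeterminate `u i`. -/
def u (r : ℕ) (i : Fin r) : RatField r :=
  algebraMap (MvPolynomial (Option (Fin r)) ℤ) _ (MvPolynomial.X (some i))

/-- `ρ = u 1 ⋯ u r` for `r` odd and `ρ = q⁻¹ u 1 ⋯ u r` for `r` even. -/
def ρ (r : ℕ) : RatField r := if Odd r then ∏ i, u r i else (q r)⁻¹ * ∏ i, u r i

/-- `δ n = ∑ j, γ j (u j)^n`. -/
def δ (r n : ℕ) : RatField r := ∑ j, gammaCoeff (ρ r) (q r) (u r) j * u r j ^ n

/-- The universal `u`-admissible ring `ℤ[q^{±1}, (u i)^{±1}][(q⁻¹ - q)⁻¹][(δ 0)⁻¹]`, as a subring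
of `ℚ(q, u 1, …, u r)`. -/
def ring (r : ℕ) : Subring (RatField r) :=
  Subring.closure ({q r, (q r)⁻¹, ((q r)⁻¹ - q r)⁻¹, (δ r 0)⁻¹} ∪
    {x | ∃ i, x = u r i ∨ x = (u r i)⁻¹})

/-- The ground ring parameters of the universal `u`-admissible ring are `ρ`, `q`, `δ n`, `u i`. -/
structure IsParameters {r : ℕ} (P : GroundRing r (ring r)) : Prop where
  rho_eq : ((P.ρ : ring r) : RatField r) = ρ r
  q_eq : ((P.q : ring r) : RatField r) = q r
  delta_eq : ∀ n, (P.δ n : RatField r) = δ r n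
  u_eq : ∀ i, ((P.u i : ring r) : RatField r) = u r i

end

end UniversalU

/-! The ring `R₀` is built from the equations alone: divide the polynomial ring on names for the
parameters and their inverses by the admissibility equations, invert `q - q⁻¹`, and keep the subring
generated by the parameters. An admissible `S` embeds in its localization at `q - q⁻¹`, so the
induced homomorphism of localizations carries this subring into `S`
(`UniversalAdmissible.exists_map_parameters`).

The domain `R₊` is the subring of `ℚ(q, u 1, …, u r)` generated by the parameters that the `γ j`
define. The computational core is that these satisfy the admissibility equations
(`relations_of_gammaCoeff`). Put `f = ∏ (X - u i)`, with coefficients `a j`, and `g = ∏ (u i * X -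
1)`, up to sign the reversal of `f`. Then `γ i * u i` is the value at `u i` of some `y - c * g`,
divided by `f'(u i)`; here `c` is a constant and `y` comes from dividing `g + X * f` (`r` odd) or `f
- g` (`r` even) by `X ^ 2 - 1`. So the sum of the `a (j + ℓ) * δ j` runs over the roots of `f`, and
Lagrange interpolation evaluates it in terms of coefficients (`residueSum_mul_divByMonic`). Division
by `X ^ 2 - 1` is the source of the sums of the `a (2 * j - ℓ)`.

For universality among domains, the equation between `ρ` and `a 0` splits into two linear factors,
and the twists allowed in a morphism lead to the factor that holds in `R₊` (`exists_isNormalized`).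
Once `q - q⁻¹` is invertible, the equations determine every `δ n` recursively from `ρ`, `q` and the
`u i` (`Relations.eq_of_eq`). Hence the specialization of `q` and the `u i` to the fraction field of
`S`, extended to the localization at its kernel, gives all parameters the correct values
(`exists_map_restrict_eq`). The same recursion identifies `R₊[(q - q⁻¹)⁻¹]` with the universal
`u`-admissible ring. In `R₀`, algebraic independence and `q - q⁻¹ ≠ 0` are inherited from `R₊`
through `π`. -/

/-! ### Truncation, reversal and divisibility by `X ^ 2 - 1` -/

open Polynomial in
/-- Dividing by `X ^ n` shifts the coefficients by `n`. -/
theorem Polynomial.coeff_divByMonic_X_pow {R : Type*} [CommRing R] (P : R[X]) (n i : ℕ) :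
    (P /ₘ X ^ n).coeff i = P.coeff (i + n) := by
  nontriviality R
  have h := congrArg (fun Q => Q.coeff (i + n)) (modByMonic_add_div P (X ^ n))
  simp only [coeff_add, mul_comm (X ^ n : R[X]), coeff_mul_X_pow] at h
  rw [← h, right_eq_add]
  refine coeff_eq_zero_of_degree_lt ?_
  refine (degree_modByMonic_lt P (monic_X_pow n)).trans_le ?_
  rw [degree_X_pow]
  exact_mod_cast Nat.le_add_left n i

open Polynomial in
/-- Reducing modulo `X ^ n` truncates the coefficients. -/
theorem Polynomial.coeff_modByMonic_X_pow {R : Type*} [CommRing R] (P : R[X]) {n i : ℕ}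
    (hi : i < n) : (P %ₘ X ^ n).coeff i = P.coeff i := by
  have h := congrArg (fun Q => Q.coeff i) (modByMonic_add_div P (X ^ n))
  simp only [coeff_add, coeff_X_pow_mul', if_neg (not_le.2 hi), add_zero] at h
  exact h

open Polynomial in
-- Modulo `X ^ 2 - 1`, a power of `X` depends only on the parity of its exponent.
theorem Polynomial.X_sq_sub_one_dvd_X_pow_sub_X_pow {R : Type*} [CommRing R] {m n : ℕ}
    (h : Even (m + n)) : (X ^ 2 - 1 : R[X]) ∣ X ^ m - X ^ n := by
  wlog hmn : n ≤ m generalizing m n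
  · rw [← neg_sub (X ^ n), dvd_neg]
    exact this (by rwa [add_comm]) (by omega)
  obtain ⟨k, rfl⟩ : ∃ k, m = n + 2 * k := by
    obtain ⟨c, hc⟩ := h
    exact ⟨c - n, by omega⟩
  have h1 : (X ^ 2 - 1 : R[X]) ∣ (X ^ 2) ^ k - 1 ^ k := sub_dvd_pow_sub_pow _ _ _
  have : (X ^ (n + 2 * k) - X ^ n : R[X]) = X ^ n * ((X ^ 2) ^ k - 1 ^ k) := by
    rw [one_pow, ← pow_mul]; ring
  rw [this]
  exact h1.mul_left _

open Polynomial in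
theorem Polynomial.X_sq_sub_one_dvd_reflect_sub {R : Type*} [CommRing R] {N : ℕ} (hN : Even N)
    (P : R[X]) (hP : P.natDegree ≤ N) : (X ^ 2 - 1 : R[X]) ∣ P.reflect N - P := by
  refine induction_with_natDegree_le (fun Q => (X ^ 2 - 1 : R[X]) ∣ Q.reflect N - Q) N
    (by simp) ?_ ?_ P hP
  · intro n c _ hn
    rw [reflect_C_mul_X_pow, ← mul_sub, revAt_le hn]
    refine (X_sq_sub_one_dvd_X_pow_sub_X_pow ?_).mul_left _
    rwa [Nat.sub_add_cancel hn]
  · intro p q _ _ hp hq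
    rw [reflect_add, add_sub_add_comm]
    exact dvd_add hp hq

open Polynomial in
-- For odd `N`, reversal changes the parity of exponents, and the factor `X` restores it.
theorem Polynomial.X_sq_sub_one_dvd_X_mul_sub_reflect {R : Type*} [CommRing R] {N : ℕ}
    (hN : Odd N) (P : R[X]) (hP : P.natDegree ≤ N) :
    (X ^ 2 - 1 : R[X]) ∣ X * P - P.reflect N := by
  refine induction_with_natDegree_le (fun Q => (X ^ 2 - 1 : R[X]) ∣ X * Q - Q.reflect N) N
    (by simp) ?_ ?_ P hP
  · intro n c _ hn
    rw [reflect_C_mul_X_pow, mul_left_comm, ← mul_sub, revAt_le hn, ← pow_succ']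
    refine (X_sq_sub_one_dvd_X_pow_sub_X_pow ?_).mul_left _
    have : n + 1 + (N - n) = N + 1 := by omega
    rw [this]
    exact hN.add_one
  · intro p q _ _ hp hq
    rw [reflect_add, mul_add, add_sub_add_comm]
    exact dvd_add hp hq

/-! ### Residue sums over the roots of the nodal polynomial -/

namespace Lagrange

open Polynomial

variable {K : Type*} [Field K] {r : ℕ} (u : Fin r → K)

/-- The sum of the values of `P` at the nodes, divided by the values of the derivative of the nodal
polynomial. -/
def residueSum (P : K[X]) : K :=
  ∑ i, P.eval (u i) / ∏ j ∈ Finset.univ.erase i, (u i - u j)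

theorem residueSum_add (P Q : K[X]) :
    residueSum u (P + Q) = residueSum u P + residueSum u Q := by
  simp [residueSum, add_div, Finset.sum_add_distrib]

theorem residueSum_C_mul (c : K) (P : K[X]) :
    residueSum u (C c * P) = c * residueSum u P := by
  simp [residueSum, Finset.mul_sum, mul_div_assoc]

theorem residueSum_neg (P : K[X]) : residueSum u (-P) = -residueSum u P := by
  simp [residueSum, neg_div]

theorem residueSum_sub (P Q : K[X]) :
    residueSum u (P - Q) = residueSum u P - residueSum u Q := by
  rw [sub_eq_add_neg, residueSum_add, residueSum_neg, sub_eq_add_neg]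

theorem residueSum_congr {P Q : K[X]} (h : ∀ i, P.eval (u i) = Q.eval (u i)) :
    residueSum u P = residueSum u Q := by
  simp [residueSum, h]

variable {u}

theorem residueSum_eq_coeff (hu : Function.Injective u) {P : K[X]} (hP : P.degree < r) :
    residueSum u P = P.coeff (r - 1) := by
  have := coeff_eq_sum (s := Finset.univ) (v := u) hu.injOn (P := P) (by simpa using hP)
  simpa [residueSum] using this.symm

theorem eval_nodal_univ (i : Fin r) : (nodal Finset.univ u).eval (u i) = 0 :=
  eval_nodal_at_node (Finset.mem_univ i)

theorem natDegree_nodal_univ : (nodal Finset.univ u).natDegree = r := by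
  simp [natDegree_nodal]

theorem coeff_nodal_univ_self : (nodal Finset.univ u).coeff r = 1 := by
  have h := (nodal_monic (s := Finset.univ) (v := u)).coeff_natDegree
  rwa [natDegree_nodal_univ] at h

/-- Write `v = v₀ + X ^ (l + 1) * v₁` and `f = f₀ + X ^ (l + 1) * f₁`. Since `f` vanishes at the
nodes, `v * f₁` has the same values there as `v₀ * f₁ - f₀ * v₁`. The latter has degree at most `r -
1`, so interpolation returns its coefficient at `r - 1`, to which only the top coefficients of the
factors contribute. -/
theorem residueSum_mul_divByMonic (hu : Function.Injective u) {v : K[X]} (hv : v.natDegree ≤ r)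
    {l : ℕ} (hl : l < r) :
    residueSum u (v * (nodal Finset.univ u /ₘ X ^ (l + 1))) =
      v.coeff l - (nodal Finset.univ u).coeff l * v.coeff r := by
  set f := nodal Finset.univ u with hf
  have hmod : ∀ P : K[X], (P %ₘ X ^ (l + 1)).natDegree ≤ l := fun P => by
    have h := natDegree_modByMonic_lt P (monic_X_pow (R := K) (l + 1)) (by
      intro h
      simpa using congrArg natDegree h)
    rw [natDegree_X_pow] at h
    omega
  have hdiv : ∀ P : K[X], P.natDegree ≤ r → (P /ₘ X ^ (l + 1)).natDegree ≤ r - 1 - l :=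
    fun P hP => by
      rw [natDegree_divByMonic P (monic_X_pow _), natDegree_X_pow]
      omega
  have hfr : f.natDegree ≤ r := natDegree_nodal_univ.le
  have key : residueSum u (v * (f /ₘ X ^ (l + 1))) = residueSum u
      (v %ₘ X ^ (l + 1) * (f /ₘ X ^ (l + 1)) - f %ₘ X ^ (l + 1) * (v /ₘ X ^ (l + 1))) := by
    refine residueSum_congr u fun i => ?_
    have h1 := congrArg (eval (u i)) (modByMonic_add_div v (X ^ (l + 1)))
    have h2 := congrArg (eval (u i)) (modByMonic_add_div f (X ^ (l + 1)))
    rw [hf, eval_nodal_univ, ← hf] at h2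
    simp only [eval_add, eval_mul, eval_sub] at h1 h2 ⊢
    rw [← h1]
    linear_combination (eval (u i) (v /ₘ X ^ (l + 1))) * h2
  have hle : ∀ P Q : K[X], Q.natDegree ≤ r →
      (P %ₘ X ^ (l + 1) * (Q /ₘ X ^ (l + 1))).natDegree ≤ r - 1 := fun P Q hQ => by
    have h1 := hmod P
    have h2 := hdiv Q hQ
    exact natDegree_mul_le.trans (by omega)
  have hco : ∀ P Q : K[X], Q.natDegree ≤ r →
      (P %ₘ X ^ (l + 1) * (Q /ₘ X ^ (l + 1))).coeff (r - 1) = P.coeff l * Q.coeff r :=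
    fun P Q hQ => by
    have h := coeff_mul_add_eq_of_natDegree_le (hmod P) (hdiv Q hQ)
    rw [show l + (r - 1 - l) = r - 1 by omega, coeff_modByMonic_X_pow P l.lt_succ_self,
      coeff_divByMonic_X_pow, show r - 1 - l + (l + 1) = r by omega] at h
    exact h
  rw [key, residueSum_eq_coeff hu, coeff_sub, hco _ _ hfr, hco _ _ hv, hf,
    coeff_nodal_univ_self, mul_one]
  refine (degree_le_of_natDegree_le (natDegree_sub_le_of_le (hle v f hfr) (hle f v hv))).trans_lt ?_
  rw [max_self]
  exact_mod_cast (by omega : r - 1 < r)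

theorem eval_nodal_divByMonic (x : K) {l : ℕ} (hl : l < r) :
    (nodal Finset.univ u /ₘ X ^ (l + 1)).eval x =
      ∑ j ∈ Finset.range (r - l), (nodal Finset.univ u).coeff (j + (l + 1)) * x ^ j := by
  rw [eval_eq_sum_range' (n := r - l)]
  · simp only [coeff_divByMonic_X_pow]
  · rw [natDegree_divByMonic _ (monic_X_pow _), natDegree_X_pow, natDegree_nodal_univ]
    omega

variable (u) in
/-- The polynomial `∏ (u i * X - 1)`, up to the order of the coefficients the nodal polynomial. -/
noncomputable def dualNodal : K[X] := C ((-1) ^ r) * (nodal Finset.univ u).reflect r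

theorem coeff_dualNodal {m : ℕ} (hm : m ≤ r) :
    (dualNodal u).coeff m = (-1) ^ r * (nodal Finset.univ u).coeff (r - m) := by
  rw [dualNodal, coeff_C_mul, coeff_reflect, revAt_le hm]

theorem natDegree_dualNodal_le : (dualNodal u).natDegree ≤ r := by
  refine (natDegree_C_mul_le _ _).trans (natDegree_le_iff_coeff_eq_zero.2 fun m hm => ?_)
  rw [coeff_reflect, revAt_eq_self_of_lt hm, coeff_eq_zero_of_natDegree_lt]
  rwa [natDegree_nodal_univ]

theorem eval_dualNodal {x : K} (hx : x ≠ 0) : (dualNodal u).eval x = ∏ i, (u i * x - 1) := by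
  have := invertibleOfNonzero (inv_ne_zero hx)
  have h := eval₂_reflect_mul_pow (RingHom.id K) x⁻¹ r (nodal Finset.univ u)
    natDegree_nodal_univ.le
  rw [invOf_eq_inv, inv_inv, ← eval, ← eval] at h
  have h' : ((nodal Finset.univ u).reflect r).eval x = x ^ r * (nodal Finset.univ u).eval x⁻¹ := by
    rw [← h, mul_left_comm, ← mul_pow, mul_inv_cancel₀ hx, one_pow, mul_one]
  rw [dualNodal, eval_mul, eval_C, h', eval_nodal]
  have hc : ∀ c : K, c ^ r = ∏ _i : Fin r, c := fun c => by simp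
  rw [hc, hc, ← Finset.prod_mul_distrib, ← Finset.prod_mul_distrib]
  refine Finset.prod_congr rfl fun i _ => ?_
  field_simp
  ring

theorem coeff_zero_nodal_univ : (nodal Finset.univ u).coeff 0 = (-1) ^ r * ∏ i, u i := by
  rw [coeff_zero_eq_eval_zero, eval_nodal]
  have hc : ∀ c : K, c ^ r = ∏ _i : Fin r, c := fun c => by simp
  rw [hc, ← Finset.prod_mul_distrib]
  simp

end Lagrange

/-! ### The alternating sums of the coefficients `a (2 * j - l)` -/

/-- The difference of sums of coefficients in the admissibility relations, in a form that is
convenient for recursion. -/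
def alternatingTail {R : Type*} [AddCommGroup R] (a : ℕ → R) (r l : ℕ) : R :=
  ∑ j ∈ Finset.Ico (l + 1) ((l + r) / 2 + 1), a (2 * j - l) -
    ∑ j ∈ Finset.Ico ((l + 1) / 2) ((r + 1) / 2), a (2 * j - l)

section alternatingTail

variable {R : Type*} [AddCommGroup R] (a : ℕ → R) {r l : ℕ}

/-- If `l + 1 < ⌈r/2⌉`, the two ranges in the definition overlap and the common terms cancel; this
is the origin of the `max` and the `min`. -/
theorem alternatingTail_eq (hl : l < r) :
    alternatingTail a r l =
      ∑ j ∈ Finset.Icc (max (l + 1) ((r + 1) / 2)) ((l + r) / 2), a (2 * j - l) -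
        ∑ j ∈ Finset.Icc ((l + 1) / 2) (min l ((r + 1) / 2 - 1)), a (2 * j - l) := by
  have h1 : ∀ m n : ℕ, Finset.Icc m n = Finset.Ico m (n + 1) := fun m n => by ext; simp
  simp only [h1, alternatingTail]
  rcases Nat.lt_or_ge (l + 1) ((r + 1) / 2) with h | h
  · rw [max_eq_right h.le, min_eq_left (by omega),
      ← Finset.sum_Ico_consecutive _ h.le (by omega : (r + 1) / 2 ≤ (l + r) / 2 + 1),
      ← Finset.sum_Ico_consecutive _ (by omega : (l + 1) / 2 ≤ l + 1) h.le]
    abel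
  · rw [max_eq_left h, min_eq_right (by omega), Nat.sub_add_cancel (by omega)]

/-- Replacing `l` by `l + 2` shifts `j` by one, so each sum loses a single term: the first its
bottom term, the second its top term. -/
theorem alternatingTail_sub (hl : l + 2 ≤ r) :
    alternatingTail a r l - alternatingTail a r (l + 2) =
      a (l + 2) - a (2 * ((r + 1) / 2) - 2 - l) := by
  have h1 : ∑ j ∈ Finset.Ico (l + 1) ((l + r) / 2 + 1), a (2 * j - l) = a (l + 2) +
      ∑ j ∈ Finset.Ico (l + 2 + 1) ((l + 2 + r) / 2 + 1), a (2 * j - (l + 2)) := by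
    rw [Finset.sum_eq_sum_Ico_succ_bot (by omega), show 2 * (l + 1) - l = l + 2 by omega,
      show l + 2 + 1 = l + 1 + 1 + 1 by rfl, show (l + 2 + r) / 2 + 1 = (l + r) / 2 + 1 + 1 by omega,
      ← Finset.sum_Ico_add' _ (l + 1 + 1) _ 1]
    exact congrArg _ (Finset.sum_congr rfl fun j _ => congrArg a (by omega))
  have h2 : ∑ j ∈ Finset.Ico ((l + 1) / 2) ((r + 1) / 2), a (2 * j - l) =
      ∑ j ∈ Finset.Ico ((l + 2 + 1) / 2) ((r + 1) / 2), a (2 * j - (l + 2)) +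
        a (2 * ((r + 1) / 2) - 2 - l) := by
    obtain ⟨s, hs⟩ : ∃ s, (r + 1) / 2 = s + 1 := ⟨(r + 1) / 2 - 1, by omega⟩
    rw [hs, Finset.sum_Ico_succ_top (by omega), show (l + 2 + 1) / 2 = (l + 1) / 2 + 1 by omega,
      ← Finset.sum_Ico_add' _ ((l + 1) / 2) s 1]
    exact congrArg₂ _ (Finset.sum_congr rfl fun j _ => congrArg a (by omega))
      (congrArg a (by omega))
  rw [alternatingTail, alternatingTail, h1, h2]
  abel

theorem alternatingTail_self : alternatingTail a r r = 0 := by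
  rw [alternatingTail, Finset.Ico_eq_empty (by omega), Finset.Ico_eq_empty (by omega)]
  simp

theorem alternatingTail_pred_of_even (hr : Even r) (h0 : 1 ≤ r) :
    alternatingTail a r (r - 1) = 0 := by
  obtain ⟨s, hs⟩ := hr
  rw [alternatingTail, Finset.Ico_eq_empty (by omega), Finset.Ico_eq_empty (by omega)]
  simp

theorem alternatingTail_pred_of_odd (hr : Odd r) : alternatingTail a r (r - 1) = -a 0 := by
  obtain ⟨s, hs⟩ := hr
  rw [alternatingTail, Finset.Ico_eq_empty (by omega), show (r - 1 + 1) / 2 = s by omega,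
    show (r + 1) / 2 = s + 1 by omega]
  simp [show 2 * s - (r - 1) = 0 by omega]

/-- Two sequences with the same step-two differences and the same last two terms agree. -/
theorem eq_of_sub_add_two_eq {b c : ℕ → R} (h0 : b r = c r) (h1 : b (r - 1) = c (r - 1))
    (h : ∀ m, m + 2 ≤ r → b m - b (m + 2) = c m - c (m + 2)) {m : ℕ} (hm : m ≤ r) :
    b m = c m := by
  obtain ⟨d, hd⟩ : ∃ d, m + d = r := ⟨r - m, by omega⟩
  induction d using Nat.strong_induction_on generalizing m with
  | _ d ih =>
    match d with
    | 0 => rw [add_zero] at hd; rwa [hd]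
    | 1 => rwa [show m = r - 1 by omega]
    | d + 2 =>
      have h2 := @ih d (by omega) (m + 2) (by omega) (by omega)
      have h3 := h m (by omega)
      rw [h2] at h3
      exact sub_left_injective h3

end alternatingTail

/-! ### Quotients by `X ^ 2 - 1` -/

namespace Lagrange

open Polynomial

variable {K : Type*} [Field K] {r : ℕ} {u : Fin r → K}

theorem natDegree_le_of_X_sq_sub_one_mul {w : K[X]} {n : ℕ}
    (h : ((X ^ 2 - 1) * w).natDegree ≤ n + 2) : w.natDegree ≤ n := by
  have hm : (X ^ 2 - 1 : K[X]).Monic := monic_X_pow_sub_C 1 two_ne_zero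
  have hd : (X ^ 2 - 1 : K[X]).natDegree = 2 := natDegree_X_pow_sub_C
  rcases eq_or_ne w 0 with rfl | hw
  · simp
  · rw [hm.natDegree_mul' hw, hd] at h
    omega

theorem coeff_sub_coeff_add_two (w : K[X]) (m : ℕ) :
    w.coeff m - w.coeff (m + 2) = ((X ^ 2 - 1) * w).coeff (m + 2) := by
  rw [sub_mul, one_mul, coeff_sub, mul_comm (X ^ 2 : K[X]), coeff_mul_X_pow]

/-- At a node, `(X ^ 2 - 1) * w` takes the value of `dualNodal u`, which is what the term `1` in `γ`
requires. Division by `X ^ 2 - 1` gives the coefficients a recursion of step two, the one satisfied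
by `alternatingTail`; the entries at `r` and `r - 1` then fix them. -/
theorem exists_quotient_of_odd (hr : Odd r) : ∃ w : K[X],
    (X ^ 2 - 1) * w = dualNodal u + X * nodal Finset.univ u ∧ (X * w).natDegree ≤ r ∧
    (∀ l < r, (X * w).coeff l - (nodal Finset.univ u).coeff l * (X * w).coeff r =
      alternatingTail (nodal Finset.univ u).coeff r l) ∧
    (X * w).coeff 0 - (nodal Finset.univ u).coeff 0 * (X * w).coeff r =
      -(nodal Finset.univ u).coeff 0 := by
  set f := nodal Finset.univ u with hf
  have hfd : f.natDegree = r := natDegree_nodal_univ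
  obtain ⟨w, hw⟩ := X_sq_sub_one_dvd_X_mul_sub_reflect hr f hfd.le
  have hw' : (X ^ 2 - 1) * w = dualNodal u + X * f := by
    rw [← hw, dualNodal, hr.neg_one_pow, ← hf]; simp; ring
  have hr1 : 1 ≤ r := hr.pos
  have hdeg : w.natDegree ≤ r - 1 := by
    refine natDegree_le_of_X_sq_sub_one_mul ?_
    rw [hw', show r - 1 + 2 = r + 1 by omega]
    refine natDegree_add_le_of_degree_le
      ((natDegree_dualNodal_le (u := u)).trans r.le_succ) ?_
    exact natDegree_mul_le.trans (by rw [natDegree_X, hfd, add_comm])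
  have hdeg' : (X * w).natDegree ≤ r := by
    refine natDegree_mul_le.trans ?_
    rw [natDegree_X]; omega
  have hzero : ∀ m, r < m → (X * w).coeff m = 0 := fun m hm =>
    coeff_eq_zero_of_natDegree_lt (hdeg'.trans_lt hm)
  have hstep : ∀ m, (X * w).coeff m - (X * w).coeff (m + 2) =
      (dualNodal u).coeff (m + 1) + f.coeff m := fun m => by
    rw [coeff_sub_coeff_add_two, mul_left_comm, hw', coeff_X_mul, coeff_add, coeff_X_mul]
  have hgz : (dualNodal u).coeff (r + 1) = 0 :=
    coeff_eq_zero_of_natDegree_lt (natDegree_dualNodal_le.trans_lt r.lt_succ_self)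
  have htop : (X * w).coeff r = 1 := by
    have h := hstep r
    rwa [hzero (r + 2) (by omega), hgz, hf, coeff_nodal_univ_self, sub_zero, zero_add] at h
  refine ⟨w, hw', hdeg', fun l hl => ?_, by rw [htop]; simp⟩
  rw [htop, mul_one]
  refine eq_of_sub_add_two_eq (r := r) (b := fun l => (X * w).coeff l - f.coeff l) ?_ ?_ ?_ hl.le
  · simp only [htop, alternatingTail_self, hf, coeff_nodal_univ_self, sub_self]
  · have h := hstep (r - 1)
    rw [hzero (r - 1 + 2) (by omega), show r - 1 + 1 = r by omega, coeff_dualNodal le_rfl, hr.neg_one_pow,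
      Nat.sub_self, sub_zero, ← hf] at h
    simp only [h, alternatingTail_pred_of_odd _ hr]
    ring
  · intro m hm
    have h := hstep m
    rw [coeff_dualNodal (by omega), hr.neg_one_pow, ← hf] at h
    obtain ⟨s, hs⟩ := hr
    rw [alternatingTail_sub _ hm, show 2 * ((r + 1) / 2) - 2 - m = r - (m + 1) by omega]
    linear_combination h

/-- The same recursion as for odd `r`, now with `deg w ≤ r - 2`, so that it starts from two zeros.
-/
theorem exists_quotient_of_even (hr : Even r) (h1 : 1 ≤ r) : ∃ w : K[X],
    (X ^ 2 - 1) * w = nodal Finset.univ u - dualNodal u ∧ w.natDegree ≤ r ∧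
    (∀ l < r, w.coeff l - (nodal Finset.univ u).coeff l * w.coeff r =
      alternatingTail (nodal Finset.univ u).coeff r l) ∧
    w.coeff 0 - (nodal Finset.univ u).coeff 0 * w.coeff r =
      1 - (nodal Finset.univ u).coeff 0 := by
  set f := nodal Finset.univ u with hf
  have hfd : f.natDegree = r := natDegree_nodal_univ
  obtain ⟨w, hw⟩ := X_sq_sub_one_dvd_reflect_sub hr f hfd.le
  have hw' : (X ^ 2 - 1) * -w = f - dualNodal u := by
    rw [mul_neg, ← hw, dualNodal, hr.neg_one_pow, ← hf]; simp
  generalize -w = w at hw'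
  have hr2 : 2 ≤ r := by
    obtain ⟨s, hs⟩ := hr
    omega
  have hdeg : w.natDegree ≤ r - 2 := by
    refine natDegree_le_of_X_sq_sub_one_mul ?_
    rw [hw', Nat.sub_add_cancel hr2]
    exact (natDegree_sub_le_of_le hfd.le natDegree_dualNodal_le).trans_eq (max_self r)
  have hzero : ∀ m, r - 2 < m → w.coeff m = 0 := fun m hm =>
    coeff_eq_zero_of_natDegree_lt (hdeg.trans_lt hm)
  refine ⟨w, hw', hdeg.trans (Nat.sub_le _ _), fun l hl => ?_, ?_⟩
  · rw [hzero r (by omega), mul_zero, sub_zero]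
    refine eq_of_sub_add_two_eq (r := r) (b := w.coeff) ?_ ?_ ?_ hl.le
    · rw [hzero r (by omega), alternatingTail_self]
    · rw [hzero _ (by omega), alternatingTail_pred_of_even _ hr h1]
    · intro m hm
      obtain ⟨s, hs⟩ := id hr
      rw [coeff_sub_coeff_add_two, hw', alternatingTail_sub _ hm, coeff_sub,
        coeff_dualNodal hm, hr.neg_one_pow, one_mul,
        show 2 * ((r + 1) / 2) - 2 - m = r - (m + 2) by omega]
  · have h := congrArg (fun P => P.coeff 0) hw'
    simp only [sub_mul, one_mul, coeff_sub, coeff_dualNodal (Nat.zero_le r), hr.neg_one_pow,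
      Nat.sub_zero, coeff_nodal_univ_self, coeff_X_pow_mul', if_neg (show ¬ 2 ≤ 0 by omega)] at h
    rw [hzero r (by omega)]
    linear_combination -h

end Lagrange

/-! ### The `γ j` as residues -/

section gammaCoeff

open Polynomial Lagrange

variable {K : Type*} [Field K] {r : ℕ} {u : Fin r → K} {ρ q : K}

/-- The factor `u i` completes the product of the other `u ℓ` to `∏ j, u j`, and `1 - u i ^ 2`
completes the product of the `u ℓ * u i - 1` to minus the value of `dualNodal u`. The other summand
of `γ` lacks this factor; `v` describes it through its multiple by `u i ^ 2 - 1`. -/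
theorem gammaCoeff_mul_eq (hu0 : ∀ i, u i ≠ 0) (hu1 : ∀ i, u i * u i ≠ 1) (i : Fin r) {e v : K}
    (he : (if Odd r then 1 else -u i) = e)
    (hv : e * u i * (dualNodal u).eval (u i) = (u i ^ 2 - 1) * v) :
    gammaCoeff ρ q u i * u i =
      (v - (∏ j, u j) / (ρ * (q⁻¹ - q)) * (dualNodal u).eval (u i)) /
        ∏ j ∈ Finset.univ.erase i, (u i - u j) := by
  have h1 : u i ^ 2 - 1 ≠ 0 := by
    rw [pow_two]
    exact sub_ne_zero.2 (hu1 i)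
  have hg : (dualNodal u).eval (u i) =
      (u i ^ 2 - 1) * ∏ j ∈ Finset.univ.erase i, (u j * u i - 1) := by
    rw [eval_dualNodal (hu0 i), ← Finset.mul_prod_erase _ _ (Finset.mem_univ i), pow_two]
  have hv' : v = e * u i * ∏ j ∈ Finset.univ.erase i, (u j * u i - 1) := by
    rw [hg] at hv
    exact mul_left_cancel₀ h1 (by linear_combination -hv)
  rw [gammaCoeff, he, hv', hg, ← Finset.mul_prod_erase _ _ (Finset.mem_univ i),
    Finset.prod_div_distrib]
  ring

/-- The value that the parameters `δ n` take in terms of the `u i`. -/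
theorem sum_gammaCoeff_mul_eval (hr : 1 ≤ r) (hu : Function.Injective u) (hu0 : ∀ i, u i ≠ 0)
    (hu1 : ∀ i, u i * u i ≠ 1) :
    (∀ l < r, ∑ i, gammaCoeff ρ q u i * u i * (nodal Finset.univ u /ₘ X ^ (l + 1)).eval (u i) =
      alternatingTail (nodal Finset.univ u).coeff r l -
        ((∏ j, u j) / (ρ * (q⁻¹ - q)) + if Odd r then 0 else 1) *
          ((-1) ^ r * (nodal Finset.univ u).coeff (r - l) -
            (∏ j, u j) * (nodal Finset.univ u).coeff l)) ∧
    alternatingTail (nodal Finset.univ u).coeff r 0 =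
      (if Odd r then 0 else 1) - (nodal Finset.univ u).coeff 0 := by
  set p := ∏ j, u j with hp
  set f := nodal Finset.univ u with hf
  set c := p / (ρ * (q⁻¹ - q)) with hc
  obtain ⟨y, hyd, hyl, hy0, hγ⟩ : ∃ y : K[X], y.natDegree ≤ r ∧
      (∀ l < r, y.coeff l - f.coeff l * y.coeff r = alternatingTail f.coeff r l) ∧
      (y.coeff 0 - f.coeff 0 * y.coeff r = (if Odd r then 0 else 1) - f.coeff 0) ∧
      ∀ i, gammaCoeff ρ q u i * u i =
        (y - C (c + if Odd r then 0 else 1) * dualNodal u).eval (u i) /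
          ∏ j ∈ Finset.univ.erase i, (u i - u j) := by
    rcases Nat.even_or_odd r with h | h
    · have h' : ¬ Odd r := Nat.not_odd_iff_even.2 h
      obtain ⟨w, hw, hwd, hwl, hw0⟩ := exists_quotient_of_even (u := u) h hr
      refine ⟨w, hwd, hwl, by rw [if_neg h']; exact hw0, fun i => ?_⟩
      have hwi := congrArg (eval (u i)) hw
      simp only [eval_mul, eval_sub, eval_pow, eval_X, eval_one, eval_nodal_univ] at hwi
      -- At a node, `(u ^ 2 - 1) * w = -g` and hence `(u ^ 2 - 1) * (w - g) = -u ^ 2 * g`. The extra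
      -- `-g` accounts for the summand `1` in the constant when `r` is even.
      rw [gammaCoeff_mul_eq hu0 hu1 i (if_neg h')
        (v := w.eval (u i) - (dualNodal u).eval (u i)), if_neg h']
      · simp only [eval_sub, eval_mul, eval_C]
        ring
      · linear_combination -hwi
    · obtain ⟨w, hw, hwd, hwl, hw0⟩ := exists_quotient_of_odd (u := u) h
      refine ⟨X * w, hwd, hwl, by rw [if_pos h, zero_sub]; exact hw0, fun i => ?_⟩
      have hwi := congrArg (eval (u i)) hw
      simp only [eval_mul, eval_sub, eval_add, eval_pow, eval_X, eval_one, eval_nodal_univ] at hwi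
      rw [gammaCoeff_mul_eq hu0 hu1 i (if_pos h) (v := u i * w.eval (u i)), if_pos h]
      · simp only [eval_sub, eval_mul, eval_C, eval_X]
        ring
      · linear_combination -u i * hwi
  have hD : ∀ l < r, y.coeff l - f.coeff l * y.coeff r = residueSum u (y * (f /ₘ X ^ (l + 1))) :=
    fun l hl => (residueSum_mul_divByMonic hu hyd hl).symm
  refine ⟨fun l hl => ?_, (hyl 0 hr).symm.trans hy0⟩
  have hg := residueSum_mul_divByMonic hu (natDegree_dualNodal_le (u := u)) hl
  rw [coeff_dualNodal hl.le, coeff_dualNodal le_rfl, Nat.sub_self, coeff_zero_nodal_univ, ← hf,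
    ← hp] at hg
  have hpow : ((-1 : K) ^ r) * (-1) ^ r = 1 := by
    rw [← mul_pow]; simp
  have key : ∑ i, gammaCoeff ρ q u i * u i * (f /ₘ X ^ (l + 1)).eval (u i) =
      residueSum u ((y - C (c + if Odd r then 0 else 1) * dualNodal u) * (f /ₘ X ^ (l + 1))) := by
    rw [residueSum]
    refine Finset.sum_congr rfl fun i _ => ?_
    rw [hγ, eval_mul, div_mul_eq_mul_div]
  rw [key, sub_mul, residueSum_sub, mul_assoc, residueSum_C_mul, hg, ← hD l hl, hyl l hl]
  linear_combination (c + if Odd r then 0 else 1) * p * f.coeff l * hpow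

end gammaCoeff

/-! ### The admissibility equations: functoriality, recursion for `δ`, subrings -/

namespace GroundRing

variable {r : ℕ} {S : Type v} [CommRing S] {T : Type w} [CommRing T]

/-- The equations between the parameters in the definition of admissibility, without the condition
on `q - q⁻¹`. -/
structure Relations (P : GroundRing r S) : Prop where
  rel_ell : ∀ ℓ : ℕ, 1 ≤ ℓ → ℓ ≤ r - 1 →
    (P.ρ : S) * (P.a ℓ - P.a (r - ℓ) * (↑P.aZero⁻¹ : S)) +
      P.qDiff *
        ((∑ j ∈ Finset.Icc 1 (r - ℓ), P.a (j + ℓ) * P.δ j)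
          - (∑ j ∈ Finset.Icc (max (ℓ + 1) ((r + 1) / 2)) ((ℓ + r) / 2), P.a (2 * j - ℓ))
          + ∑ j ∈ Finset.Icc ((ℓ + 1) / 2) (min ℓ ((r + 1) / 2 - 1)), P.a (2 * j - ℓ)) = 0
  rel_rho : (↑P.ρ⁻¹ : S) * P.a 0 - (P.ρ : S) * (↑P.aZero⁻¹ : S) = if Odd r then 0 else P.qDiff
  rel_delta : ∀ n : ℕ, r ≤ n → P.δ n = -∑ j ∈ Finset.range r, P.a j * P.δ (n - r + j)

theorem IsAdmissible.relations {P : GroundRing r S} (h : P.IsAdmissible) : P.Relations :=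
  ⟨h.rel_ell, h.rel_rho, h.rel_delta⟩

theorem Relations.isAdmissible {P : GroundRing r S} (h : P.Relations) (h0 : P.qDiff ≠ 0)
    (h1 : P.qDiff ∈ nonZeroDivisors S) : P.IsAdmissible :=
  ⟨h0, h1, h.rel_ell, h.rel_rho, h.rel_delta⟩

theorem ext_of_coe {P Q : GroundRing r S} (hρ : (P.ρ : S) = Q.ρ) (hq : (P.q : S) = Q.q)
    (hδ : ∀ n, P.δ n = Q.δ n) (hu : ∀ i, (P.u i : S) = Q.u i) : P = Q := by
  obtain ⟨ρ, q, δ, u, _, _⟩ := P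
  obtain ⟨ρ', q', δ', u', _, _⟩ := Q
  obtain rfl : ρ = ρ' := Units.ext hρ
  obtain rfl : q = q' := Units.ext hq
  obtain rfl : δ = δ' := funext hδ
  obtain rfl : u = u' := funext fun i => Units.ext (hu i)
  rfl

section map

variable (P : GroundRing r S) (f : S →+* T)

@[simp] theorem coe_map_ρ : ((P.map f).ρ : T) = f P.ρ := rfl
@[simp] theorem coe_map_ρ_inv : (↑(P.map f).ρ⁻¹ : T) = f (↑P.ρ⁻¹ : S) := rfl
@[simp] theorem coe_map_q : ((P.map f).q : T) = f P.q := rfl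
@[simp] theorem coe_map_q_inv : (↑(P.map f).q⁻¹ : T) = f (↑P.q⁻¹ : S) := rfl
@[simp] theorem map_δ (n : ℕ) : (P.map f).δ n = f (P.δ n) := rfl
@[simp] theorem coe_map_u (i : Fin r) : ((P.map f).u i : T) = f (P.u i) := rfl
@[simp] theorem coe_map_u_inv (i : Fin r) : (↑((P.map f).u i)⁻¹ : T) = f (↑(P.u i)⁻¹ : S) := rfl

@[simp] theorem map_a (j : ℕ) : (P.map f).a j = f (P.a j) := by
  simp [a, map_sum, map_prod]

@[simp] theorem map_qDiff : (P.map f).qDiff = f P.qDiff := by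
  simp [qDiff]

theorem map_aZero : (P.map f).aZero = Units.map (f : S →* T) P.aZero :=
  Units.ext (by rw [coe_aZero, map_a, Units.coe_map, coe_aZero]; rfl)

@[simp] theorem coe_map_aZero_inv : (↑(P.map f).aZero⁻¹ : T) = f (↑P.aZero⁻¹ : S) := by
  rw [map_aZero]; rfl

variable {P f}

theorem Relations.map (h : P.Relations) (f : S →+* T) : (P.map f).Relations where
  rel_ell l h1 h2 := by simpa using congrArg f (h.rel_ell l h1 h2)
  rel_rho := by
    have := congrArg f h.rel_rho
    split_ifs at this ⊢ <;> simpa using this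
  rel_delta n hn := by simpa using congrArg f (h.rel_delta n hn)

theorem Relations.of_map (hf : Function.Injective f) (h : (P.map f).Relations) :
    P.Relations where
  rel_ell l h1 h2 := hf (by simpa using h.rel_ell l h1 h2)
  rel_rho := hf (by
    have := h.rel_rho
    split_ifs at this ⊢ <;> simpa using this)
  rel_delta n hn := hf (by simpa using h.rel_delta n hn)

theorem isMorphism_map : P.IsMorphism (P.map f) f :=
  ⟨.inl ⟨rfl, .inl rfl⟩, fun _ => rfl, fun _ => rfl⟩

end map

theorem a_self (P : GroundRing r S) : P.a r = 1 := by simp [a]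

theorem delta_zero_eq (P : GroundRing r S) {t : S} (ht : t * P.qDiff = 1) :
    P.δ 0 = 1 - t * ((↑P.ρ⁻¹ : S) - P.ρ) := by
  have := P.rel
  rw [qDiff] at ht
  linear_combination (1 - P.δ 0) * ht + t * this

/-- In the relation for `ℓ = r - (m + 1)`, the last `δ` is `δ (m + 1)`, with coefficient `a r = 1`
times `q - q⁻¹`; multiplying by `t` solves for it. -/
theorem Relations.delta_eq {P : GroundRing r S} (h : P.Relations) {t : S} (ht : t * P.qDiff = 1)
    {m : ℕ} (h1 : m + 1 < r) :
    P.δ (m + 1) = -(∑ j ∈ Finset.Icc 1 m, P.a (j + (r - (m + 1))) * P.δ j)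
      + (∑ j ∈ Finset.Icc (max (r - (m + 1) + 1) ((r + 1) / 2)) ((r - (m + 1) + r) / 2),
          P.a (2 * j - (r - (m + 1))))
      - (∑ j ∈ Finset.Icc ((r - (m + 1) + 1) / 2) (min (r - (m + 1)) ((r + 1) / 2 - 1)),
          P.a (2 * j - (r - (m + 1))))
      - t * ((P.ρ : S) * (P.a (r - (m + 1)) - P.a (m + 1) * (↑P.aZero⁻¹ : S))) := by
  have h2 := h.rel_ell (r - (m + 1)) (by omega) (by omega)
  rw [show r - (r - (m + 1)) = m + 1 by omega, Finset.sum_Icc_succ_top (by omega),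
    show m + 1 + (r - (m + 1)) = r by omega, a_self, one_mul] at h2
  linear_combination t * h2 - (∑ j ∈ Finset.Icc 1 m, P.a (j + (r - (m + 1))) * P.δ j + P.δ (m + 1)
      - (∑ j ∈ Finset.Icc (max (r - (m + 1) + 1) ((r + 1) / 2)) ((r - (m + 1) + r) / 2),
          P.a (2 * j - (r - (m + 1))))
      + (∑ j ∈ Finset.Icc ((r - (m + 1) + 1) / 2) (min (r - (m + 1)) ((r + 1) / 2 - 1)),
          P.a (2 * j - (r - (m + 1))))) * ht

/-- If `q - q⁻¹` is invertible, then the parameters `δ n` are determined by the others. -/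
theorem Relations.eq_of_eq {P Q : GroundRing r S} (hP : P.Relations)
    (hQ : Q.Relations) (hρ : P.ρ = Q.ρ) (hq : P.q = Q.q) (hu : P.u = Q.u)
    (hunit : IsUnit P.qDiff) : P = Q := by
  obtain ⟨t, ht⟩ := hunit.exists_left_inv
  have ha : P.a = Q.a := by funext j; simp [a, hu]
  have ha0 : P.aZero = Q.aZero := by simp [aZero, hu]
  have hqd : P.qDiff = Q.qDiff := by simp [qDiff, hq]
  have hδ : ∀ n, P.δ n = Q.δ n := by
    intro n
    induction n using Nat.strong_induction_on with
    | _ n ih =>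
      rcases Nat.lt_or_ge n r with h | h
      · cases n with
        | zero => rw [P.delta_zero_eq ht, Q.delta_zero_eq (hqd ▸ ht), hρ]
        | succ m =>
          rw [hP.delta_eq ht h, hQ.delta_eq (hqd ▸ ht) h, ha, ha0, hρ]
          refine congrArg (fun x => -x + _ - _ - _) (Finset.sum_congr rfl fun j hj => ?_)
          rw [ih j (by have := (Finset.mem_Icc.1 hj).2; omega)]
      · rw [hP.rel_delta n h, hQ.rel_delta n h, ha]
        refine congrArg _ (Finset.sum_congr rfl fun j hj => ?_)
        rw [ih _ (by have := Finset.mem_range.1 hj; omega)]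
  exact ext_of_coe (by rw [hρ]) (by rw [hq]) hδ fun i => by rw [hu]

section mem

variable {P : GroundRing r S} {A : Subring S}

theorem a_mem (hu : ∀ i, (P.u i : S) ∈ A) (j : ℕ) : P.a j ∈ A :=
  mul_mem (pow_mem (neg_mem (one_mem A)) _)
    (sum_mem fun _ _ => prod_mem fun i _ => hu i)

theorem coe_aZero_inv (P : GroundRing r S) :
    (↑P.aZero⁻¹ : S) = (-1) ^ r * ∏ i, (↑(P.u i)⁻¹ : S) := by
  simp [aZero, ← inv_pow, ← Finset.prod_inv_distrib, mul_comm]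

theorem aZero_inv_mem (hu : ∀ i, (↑(P.u i)⁻¹ : S) ∈ A) : (↑P.aZero⁻¹ : S) ∈ A := by
  rw [coe_aZero_inv]
  exact mul_mem (pow_mem (neg_mem (one_mem A)) _) (prod_mem fun i _ => hu i)

theorem Relations.delta_mem_of_lt (h : P.Relations) (hu : ∀ i, (P.u i : S) ∈ A)
    (hδ : ∀ j < r, P.δ j ∈ A) (n : ℕ) : P.δ n ∈ A := by
  induction n using Nat.strong_induction_on with
  | _ n ih =>
    rcases Nat.lt_or_ge n r with hn | hn
    · exact hδ n hn
    · rw [h.rel_delta n hn]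
      refine neg_mem (sum_mem fun j hj => mul_mem (a_mem hu j) (ih _ ?_))
      have := Finset.mem_range.1 hj
      omega

theorem Relations.delta_mem (h : P.Relations) (hρ : (P.ρ : S) ∈ A) (hρ' : (↑P.ρ⁻¹ : S) ∈ A)
    (hu : ∀ i, (P.u i : S) ∈ A) (hu' : ∀ i, (↑(P.u i)⁻¹ : S) ∈ A) {t : S} (htA : t ∈ A)
    (ht : t * P.qDiff = 1) (n : ℕ) : P.δ n ∈ A := by
  refine h.delta_mem_of_lt hu (fun j hj => ?_) n
  induction j using Nat.strong_induction_on with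
  | _ j ih =>
    cases j with
    | zero =>
      rw [P.delta_zero_eq ht]
      exact sub_mem (one_mem A) (mul_mem htA (sub_mem hρ' hρ))
    | succ m =>
      rw [h.delta_eq ht hj]
      refine sub_mem (sub_mem (add_mem (neg_mem (sum_mem fun j hj' => mul_mem (a_mem hu _) ?_))
        (sum_mem fun _ _ => a_mem hu _)) (sum_mem fun _ _ => a_mem hu _)) (mul_mem htA
        (mul_mem hρ (sub_mem (a_mem hu _) (mul_mem (a_mem hu _) (aZero_inv_mem hu')))))
      have := (Finset.mem_Icc.1 hj').2
      exact ih j (by omega) (by omega)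

end mem

section restrict

variable (P : GroundRing r S) (A : Subring S)

theorem generators_subset_iff : P.generators ⊆ A ↔
    ((P.q : S) ∈ A ∧ (↑P.q⁻¹ : S) ∈ A ∧ (P.ρ : S) ∈ A ∧ (↑P.ρ⁻¹ : S) ∈ A ∧
      (↑P.isUnit_δ_zero.unit⁻¹ : S) ∈ A) ∧ (∀ j < r, P.δ j ∈ A) ∧
      ∀ i, (P.u i : S) ∈ A ∧ (↑(P.u i)⁻¹ : S) ∈ A := by
  constructor
  · intro h
    exact ⟨⟨h (by simp [generators]), h (by simp [generators]), h (by simp [generators]),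
      h (by simp [generators]), h (by simp [generators])⟩,
      fun j hj => h (.inl (.inr ⟨j, hj, rfl⟩)),
      fun i => ⟨h (.inr ⟨i, .inl rfl⟩), h (.inr ⟨i, .inr rfl⟩)⟩⟩
  · rintro ⟨⟨h1, h2, h3, h4, h5⟩, hδ, hu⟩ x ((hx | ⟨j, hj, rfl⟩) | ⟨i, rfl | rfl⟩)
    · rcases hx with rfl | rfl | rfl | rfl | rfl
      exacts [h1, h2, h3, h4, h5]
    · exact hδ j hj
    · exact (hu i).1
    · exact (hu i).2

/-- The parameters of `S` as parameters of a subring that contains them. -/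
def restrict (hP : P.Relations) (hA : P.generators ⊆ A) : GroundRing r A :=
  have h := (P.generators_subset_iff A).1 hA
  have hδ : ∀ n, P.δ n ∈ A := hP.delta_mem_of_lt (fun i => (h.2.2 i).1) h.2.1
  { ρ := ⟨⟨P.ρ, h.1.2.2.1⟩, ⟨(↑P.ρ⁻¹ : S), h.1.2.2.2.1⟩, Subtype.ext P.ρ.mul_inv,
      Subtype.ext P.ρ.inv_mul⟩
    q := ⟨⟨P.q, h.1.1⟩, ⟨(↑P.q⁻¹ : S), h.1.2.1⟩, Subtype.ext P.q.mul_inv,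
      Subtype.ext P.q.inv_mul⟩
    δ := fun n => ⟨P.δ n, hδ n⟩
    u := fun i => ⟨⟨P.u i, (h.2.2 i).1⟩, ⟨(↑(P.u i)⁻¹ : S), (h.2.2 i).2⟩,
      Subtype.ext (P.u i).mul_inv, Subtype.ext (P.u i).inv_mul⟩
    isUnit_δ_zero := IsUnit.of_mul_eq_one ⟨_, h.1.2.2.2.2⟩
      (Subtype.ext (IsUnit.mul_val_inv P.isUnit_δ_zero))
    rel := Subtype.ext P.rel }

variable {P A} (hP : P.Relations) (hA : P.generators ⊆ A)

theorem map_restrict : (P.restrict A hP hA).map A.subtype = P := rfl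

theorem generators_map (f : S →+* T) : (P.map f).generators = f '' P.generators := by
  have h : (↑(P.map f).isUnit_δ_zero.unit⁻¹ : T) = f (↑P.isUnit_δ_zero.unit⁻¹ : S) := by
    have : (P.map f).isUnit_δ_zero.unit = Units.map (f : S →* T) P.isUnit_δ_zero.unit :=
      Units.ext rfl
    rw [this]; rfl
  simp only [generators, Set.image_union]
  refine congrArg₂ _ (congrArg₂ _ ?_ ?_) ?_
  · rw [h]
    simp [Set.image_insert_eq]
  · ext x
    constructor
    · rintro ⟨j, hj, rfl⟩
      exact ⟨_, ⟨j, hj, rfl⟩, rfl⟩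
    · rintro ⟨_, ⟨j, hj, rfl⟩, rfl⟩
      exact ⟨j, hj, rfl⟩
  · ext x
    constructor
    · rintro ⟨i, rfl | rfl⟩
      exacts [⟨_, ⟨i, .inl rfl⟩, rfl⟩, ⟨_, ⟨i, .inr rfl⟩, rfl⟩]
    · rintro ⟨_, ⟨i, rfl | rfl⟩, rfl⟩
      exacts [⟨i, .inl rfl⟩, ⟨i, .inr rfl⟩]

theorem closure_generators_restrict (hA' : A = Subring.closure P.generators) :
    Subring.closure (P.restrict A hP hA).generators = ⊤ := by
  have h : (Subring.closure (P.restrict A hP hA).generators).map A.subtype = A := by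
    rw [RingHom.map_closure, ← generators_map, map_restrict, ← hA']
  refine eq_top_iff.2 fun x _ => ?_
  obtain ⟨y, hy, hxy⟩ := Subring.mem_map.1 (h.ge x.2)
  rwa [← Subtype.ext (a1 := y) (a2 := x) hxy]

theorem relations_restrict : (P.restrict A hP hA).Relations :=
  Relations.of_map (f := A.subtype) A.subtype_injective (by rwa [map_restrict])

end restrict

/-! ### Twists of the parameters and normalization of `ρ` -/

section twist

variable (P : GroundRing r S)

/-- The parameters with `ρ` and `q` replaced by `-ρ` and `-q`. -/
def negTwist : GroundRing r S where
  ρ := -P.ρ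
  q := -P.q
  δ := P.δ
  u := P.u
  isUnit_δ_zero := P.isUnit_δ_zero
  rel := by
    have := P.rel
    simp only [Units.val_neg, inv_neg]
    linear_combination -this

/-- The parameters with `q` replaced by `-q⁻¹`. -/
def invTwist : GroundRing r S where
  ρ := P.ρ
  q := -P.q⁻¹
  δ := P.δ
  u := P.u
  isUnit_δ_zero := P.isUnit_δ_zero
  rel := by
    have := P.rel
    simp only [Units.val_neg, inv_neg, inv_inv]
    linear_combination this

variable {P}

theorem qDiff_negTwist : P.negTwist.qDiff = -P.qDiff := by
  simp [qDiff, negTwist]; ring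

theorem qDiff_invTwist : P.invTwist.qDiff = P.qDiff := by
  simp [qDiff, invTwist]; ring

/-- Both `ρ` and `q - q⁻¹` change sign, so the equations that contain them are multiplied by `-1`.
-/
theorem IsAdmissible.negTwist (h : P.IsAdmissible) : P.negTwist.IsAdmissible where
  qDiff_ne_zero := by rw [qDiff_negTwist]; exact neg_ne_zero.2 h.qDiff_ne_zero
  qDiff_mem := by 
    rw [qDiff_negTwist, ← neg_one_mul]
    exact mul_mem isUnit_one.neg.mem_nonZeroDivisors h.qDiff_mem
  rel_ell l h1 h2 := by
    have := h.rel_ell l h1 h2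
    rw [qDiff_negTwist]
    simp only [GroundRing.negTwist, Units.val_neg, aZero, a] at this ⊢
    linear_combination -this
  rel_rho := by
    have := h.rel_rho
    rw [qDiff_negTwist]
    simp only [GroundRing.negTwist, Units.val_neg, aZero, a, inv_neg] at this ⊢
    split_ifs at this ⊢ <;> linear_combination -this
  rel_delta := h.rel_delta

/-- The equations contain `q` only through `q - q⁻¹`, which this twist fixes. -/
theorem IsAdmissible.invTwist (h : P.IsAdmissible) : P.invTwist.IsAdmissible where
  qDiff_ne_zero := by rw [qDiff_invTwist]; exact h.qDiff_ne_zero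
  qDiff_mem := by rw [qDiff_invTwist]; exact h.qDiff_mem
  rel_ell l h1 h2 := by rw [qDiff_invTwist]; exact h.rel_ell l h1 h2
  rel_rho := by rw [qDiff_invTwist]; exact h.rel_rho
  rel_delta := h.rel_delta

theorem IsMorphism.of_negTwist {Q : GroundRing r T} {φ : T →+* S}
    (h : Q.map φ = P.negTwist) : Q.IsMorphism P φ := by
  refine ⟨.inr ⟨?_, .inl ?_⟩, fun j => ?_, fun i => ?_⟩
  · rw [← coe_map_ρ, h]; simp [negTwist]
  · rw [← coe_map_q, h]; simp [negTwist]
  · rw [← map_δ, h]; rfl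
  · rw [← coe_map_u, h]; rfl

theorem IsMorphism.of_invTwist {Q : GroundRing r T} {φ : T →+* S}
    (h : Q.map φ = P.invTwist) : Q.IsMorphism P φ := by
  refine ⟨.inl ⟨?_, .inr ?_⟩, fun j => ?_, fun i => ?_⟩
  · rw [← coe_map_ρ, h]; rfl
  · rw [← coe_map_q, h]; simp [invTwist]
  · rw [← map_δ, h]; rfl
  · rw [← coe_map_u, h]; rfl

variable (P) in
/-- The solution of the equation between `ρ` and `u 1, …, u r` that is used for the universal
`u`-admissible ring. -/
def IsNormalized : Prop := P.ρ = if Odd r then ∏ i, P.u i else P.q⁻¹ * ∏ i, P.u i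

/-- In an integral domain, admissible parameters can be normalized by a twist. -/
theorem IsAdmissible.exists_isNormalized [IsDomain S] (h : P.IsAdmissible) :
    ∃ P' : GroundRing r S, P'.IsAdmissible ∧ P'.IsNormalized ∧
      ∀ (R : Type) [CommRing R] (Q : GroundRing r R) (φ : R →+* S), Q.map φ = P' →
        Q.IsMorphism P φ := by
  have hrho := h.rel_rho
  rw [← coe_aZero] at hrho
  set p := ∏ i, P.u i with hp
  rcases Nat.even_or_odd r with hr | hr
  · have hr' : ¬ Odd r := Nat.not_odd_iff_even.2 hr
    have h0 : P.aZero = p := by simp [aZero, hr.neg_one_pow, hp]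
    rw [if_neg hr', h0, qDiff] at hrho
    -- Without denominators, `ρ⁻¹ * p - ρ * p⁻¹ = q - q⁻¹` is quadratic in `ρ`, with roots `q⁻¹ * p`
    -- and `-q * p`. The second becomes the first when `q` is replaced by `-q⁻¹`.
    have h1 : ((P.q : S) * P.ρ - p) * (P.q * p + P.ρ) = 0 := by
      have e1 := P.ρ.mul_inv
      have e2 := P.q.mul_inv
      have e3 := p.mul_inv
      linear_combination (-(P.ρ : S) * P.q * p) * hrho + (P.q * p ^ 2) * e1
        + (-(P.q : S) * P.ρ ^ 2) * e3 + (P.ρ * p) * e2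
    rcases mul_eq_zero.1 h1 with h1 | h1
    · refine ⟨P, h, ?_, fun R _ Q φ hφ => hφ ▸ isMorphism_map⟩
      rw [IsNormalized, if_neg hr', eq_inv_mul_iff_mul_eq]
      exact Units.ext (by rw [Units.val_mul]; exact sub_eq_zero.1 h1)
    · refine ⟨P.invTwist, h.invTwist, ?_, fun R _ Q φ hφ => IsMorphism.of_invTwist hφ⟩
      rw [IsNormalized, if_neg hr', eq_inv_mul_iff_mul_eq]
      change -P.q⁻¹ * P.ρ = p
      refine Units.ext ?_
      have e2 := P.q.inv_mul
      simp only [Units.val_mul, Units.val_neg]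
      linear_combination (-(↑P.q⁻¹ : S)) * h1 + (p : S) * e2
  · have h0 : P.aZero = -p := by simp [aZero, hr.neg_one_pow, hp]
    rw [if_pos hr, h0] at hrho
    have h1 : ((P.ρ : S) - p) * (P.ρ + p) = 0 := by
      have e1 := P.ρ.mul_inv
      have e3 := p.mul_inv
      simp only [Units.val_neg, inv_neg] at hrho
      linear_combination ((P.ρ : S) * p) * hrho + (p ^ 2 : S) * e1 - (P.ρ ^ 2 : S) * e3
    rcases mul_eq_zero.1 h1 with h1 | h1
    · refine ⟨P, h, ?_, fun R _ Q φ hφ => hφ ▸ isMorphism_map⟩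
      rw [IsNormalized, if_pos hr]
      exact Units.ext (sub_eq_zero.1 h1)
    · refine ⟨P.negTwist, h.negTwist, ?_, fun R _ Q φ hφ => IsMorphism.of_negTwist hφ⟩
      rw [IsNormalized, if_pos hr]
      change -P.ρ = p
      refine Units.ext ?_
      rw [Units.val_neg]
      linear_combination -h1

end twist

end GroundRing

/-! ### The parameters defined by the `γ j` satisfy the equations -/

section gammaCoeff

open Polynomial Lagrange

variable {K : Type v} [Field K] {r : ℕ} {u : Fin r → K} {ρ q : K}

theorem one_sub_sq_ne_zero (hq0 : q ≠ 0) (hq : q⁻¹ - q ≠ 0) : 1 - q ^ 2 ≠ 0 := fun h => hq <| by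
  have : q⁻¹ - q = q⁻¹ * (1 - q ^ 2) := by field_simp
  rw [this, h, mul_zero]

/-- This is the constant in front of `dualNodal u`. Normalization of `ρ` removes the `u i` from it;
for even `r`, `q / (q⁻¹ - q) + 1 = q⁻¹ / (q⁻¹ - q)`. -/
theorem prod_div_add_eq (hq0 : q ≠ 0) (hq : q⁻¹ - q ≠ 0) (hu0 : ∀ i, u i ≠ 0)
    (hρ : ρ = if Odd r then ∏ i, u i else q⁻¹ * ∏ i, u i) :
    (∏ i, u i) / (ρ * (q⁻¹ - q)) + (if Odd r then 0 else 1) =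
      (if Odd r then 1 else q⁻¹) / (q⁻¹ - q) := by
  have hp : ∏ i, u i ≠ 0 := Finset.prod_ne_zero_iff.2 fun i _ => hu0 i
  rw [hρ]
  split_ifs
  · rw [add_zero, div_mul_cancel_left₀ hp, one_div]
  · rw [mul_comm q⁻¹ (∏ i, u i), mul_assoc, div_mul_cancel_left₀ hp, mul_inv, inv_inv]
    have hz := one_sub_sq_ne_zero hq0 hq
    field_simp
    ring

/-- The ground relation is the missing case `l = 0`: from `f (u i) = 0` follows `u i * (f /ₘ X) (u
i) = -f 0`, so the evaluated sum is `-f 0` times the sum of the `γ i`. -/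
theorem rel_of_gammaCoeff (hr : 1 ≤ r) (hu : Function.Injective u) (hu0 : ∀ i, u i ≠ 0)
    (hu1 : ∀ i, u i * u i ≠ 1) (hq0 : q ≠ 0) (hq : q⁻¹ - q ≠ 0)
    (hρ : ρ = if Odd r then ∏ i, u i else q⁻¹ * ∏ i, u i) :
    ρ⁻¹ - ρ = (q⁻¹ - q) * (∑ i, gammaCoeff ρ q u i - 1) := by
  obtain ⟨h1, h2⟩ := sum_gammaCoeff_mul_eval (ρ := ρ) (q := q) hr hu hu0 hu1
  have h := h1 0 hr
  rw [h2, prod_div_add_eq hq0 hq hu0 hρ, Nat.sub_zero, coeff_nodal_univ_self, mul_one,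
    coeff_zero_nodal_univ] at h
  have hk : ∀ i, u i * (nodal Finset.univ u /ₘ X ^ (0 + 1)).eval (u i) =
      -((-1) ^ r * ∏ i, u i) := fun i => by
    have h3 := congrArg (eval (u i)) (modByMonic_add_div (nodal Finset.univ u) (X ^ (0 + 1)))
    rw [zero_add, pow_one, modByMonic_X, eval_nodal_univ, ← coeff_zero_eq_eval_zero,
      coeff_zero_nodal_univ] at h3
    simp only [eval_add, eval_mul, eval_C, eval_X] at h3
    rw [zero_add, pow_one]
    linear_combination h3
  simp only [mul_assoc, hk, ← Finset.sum_mul] at h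
  have hp : ∏ i, u i ≠ 0 := Finset.prod_ne_zero_iff.2 fun i _ => hu0 i
  generalize ∏ i, u i = p at *
  generalize ∑ i, gammaCoeff ρ q u i = s at *
  rcases Nat.even_or_odd r with hr' | hr'
  · rw [if_neg (Nat.not_odd_iff_even.2 hr')] at h hρ
    simp only [if_neg (Nat.not_odd_iff_even.2 hr'), hr'.neg_one_pow] at h
    rw [hρ]
    field_simp at h ⊢
    have hz := one_sub_sq_ne_zero hq0 hq
    field_simp at h
    linear_combination h
  · rw [if_pos hr'] at h hρ
    simp only [if_pos hr', hr'.neg_one_pow] at h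
    rw [hρ]
    field_simp at h ⊢
    have hz := one_sub_sq_ne_zero hq0 hq
    field_simp at h
    linear_combination -h

end gammaCoeff

namespace GroundRing

open Polynomial Lagrange

variable {r : ℕ} {K : Type v} [Field K] (P : GroundRing r K)

theorem a_eq_coeff_nodal {j : ℕ} (hj : j ≤ r) :
    P.a j = (nodal Finset.univ fun i => (P.u i : K)).coeff j := by
  have h := Multiset.prod_X_sub_C_coeff ((Finset.univ : Finset (Fin r)).val.map
    fun i => (P.u i : K)) (k := j) (by simpa using hj)
  rw [Finset.esymm_map_val, Multiset.map_map] at h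
  simp only [Multiset.card_map, Finset.card_val, Finset.card_univ, Fintype.card_fin] at h
  exact h.symm

variable {P}

/-- The relations for `ℓ` are the evaluated residue sums, the relation for `ρ` follows from
normalization, and the recursion for `δ n` holds because every `u i` is a root of `f`. -/
theorem relations_of_gammaCoeff (hr : 1 ≤ r) (hu : Function.Injective P.u)
    (hu1 : ∀ i, P.u i * P.u i ≠ 1) (hq : P.qDiff ≠ 0) (hρ : P.IsNormalized)
    (hδ : ∀ n, P.δ n = ∑ i, gammaCoeff (P.ρ : K) P.q (fun i => (P.u i : K)) i * (P.u i : K) ^ n) :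
    P.Relations := by
  set u : Fin r → K := fun i => (P.u i : K) with hu_def
  have hinj : Function.Injective u := fun i j h => hu (Units.ext h)
  have hu0 : ∀ i, u i ≠ 0 := fun i => (P.u i).ne_zero
  have hu1' : ∀ i, u i * u i ≠ 1 := fun i h => hu1 i (Units.ext h)
  have hz : (P.q : K)⁻¹ - P.q ≠ 0 := fun h => hq (by
    rw [qDiff, Units.val_inv_eq_inv_val]; linear_combination -h)
  have hρ' : (P.ρ : K) = if Odd r then ∏ i, u i else (P.q : K)⁻¹ * ∏ i, u i := by
    rw [IsNormalized] at hρ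
    rw [hρ]
    split_ifs <;> simp [u]
  have ha0 : (P.aZero : K) = (-1) ^ r * ∏ i, u i := by simp [aZero, u]
  have hp : ∏ i, u i ≠ 0 := Finset.prod_ne_zero_iff.2 fun i _ => hu0 i
  refine ⟨fun l h1 h2 => ?_, ?_, fun n hn => ?_⟩
  · have hl : l < r := by omega
    have h := (sum_gammaCoeff_mul_eval (ρ := (P.ρ : K)) (q := (P.q : K)) hr hinj hu0 hu1').1 l hl
    rw [prod_div_add_eq P.q.ne_zero hz hu0 hρ'] at h
    have hL : ∑ j ∈ Finset.Icc 1 (r - l), P.a (j + l) * P.δ j =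
        ∑ i, gammaCoeff (P.ρ : K) P.q u i * u i *
          (nodal Finset.univ u /ₘ X ^ (l + 1)).eval (u i) := by
      have hshift : ∀ F : ℕ → K,
          ∑ j ∈ Finset.Icc 1 (r - l), F j = ∑ j ∈ Finset.range (r - l), F (j + 1) := fun F => by
        rw [Finset.range_eq_Ico, Finset.sum_Ico_add' F 0 (r - l) 1]
        rfl
      simp only [hshift, eval_nodal_divByMonic _ hl, hδ, Finset.mul_sum]
      rw [Finset.sum_comm]
      refine Finset.sum_congr rfl fun i _ => Finset.sum_congr rfl fun j hj => ?_
      have := Finset.mem_range.1 hj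
      rw [P.a_eq_coeff_nodal (by omega), show j + 1 + l = j + (l + 1) by omega, pow_succ]
      ring
    -- Only the difference of the two coefficient sums matters, so both stay opaque while
    -- denominators are cleared.
    have hD : ∀ A B : K, A - B = alternatingTail (nodal Finset.univ u).coeff r l →
        (P.ρ : K) * (P.a l - P.a (r - l) * (↑P.aZero⁻¹ : K)) +
        P.qDiff * ((∑ j ∈ Finset.Icc 1 (r - l), P.a (j + l) * P.δ j) - A + B) = 0 := by
      intro A B hAB
      rw [hL, h, P.a_eq_coeff_nodal hl.le, P.a_eq_coeff_nodal (Nat.sub_le r l),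
        Units.val_inv_eq_inv_val, ha0, ← hAB, hρ', qDiff, Units.val_inv_eq_inv_val]
      have hq0 : (P.q : K) ≠ 0 := P.q.ne_zero
      have hz' := one_sub_sq_ne_zero hq0 hz
      generalize ∏ i, u i = p at *
      rcases Nat.even_or_odd r with hr' | hr'
      · simp only [if_neg (Nat.not_odd_iff_even.2 hr'), hr'.neg_one_pow]
        field_simp
        ring
      · simp only [if_pos hr', hr'.neg_one_pow]
        field_simp
        ring
    refine hD _ _ ?_
    rw [alternatingTail_eq _ hl]
    refine congrArg₂ _ (Finset.sum_congr rfl fun j hj => P.a_eq_coeff_nodal ?_)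
      (Finset.sum_congr rfl fun j hj => P.a_eq_coeff_nodal ?_)
    · have := (Finset.mem_Icc.1 hj).2
      omega
    · have := (Finset.mem_Icc.1 hj).2
      omega
  · rw [← coe_aZero, Units.val_inv_eq_inv_val, Units.val_inv_eq_inv_val, ha0, hρ', qDiff,
      Units.val_inv_eq_inv_val]
    have hq0 : (P.q : K) ≠ 0 := P.q.ne_zero
    generalize ∏ i, u i = p at *
    rcases Nat.even_or_odd r with hr' | hr'
    · simp only [if_neg (Nat.not_odd_iff_even.2 hr'), hr'.neg_one_pow]
      field_simp
    · simp only [if_pos hr', hr'.neg_one_pow]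
      field_simp
      ring
  · have hf : ∀ i, u i ^ r = -∑ j ∈ Finset.range r, P.a j * u i ^ j := fun i => by
      have h := eval_nodal_univ (u := u) i
      rw [eval_eq_sum_range' (natDegree_nodal_univ.trans_lt r.lt_succ_self),
        Finset.sum_range_succ, coeff_nodal_univ_self, one_mul] at h
      rw [eq_neg_of_add_eq_zero_right h]
      refine congrArg _ (Finset.sum_congr rfl fun j hj => ?_)
      rw [P.a_eq_coeff_nodal (Finset.mem_range.1 hj).le]
    simp only [hδ, Finset.mul_sum]
    rw [Finset.sum_comm, ← Finset.sum_neg_distrib]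
    refine Finset.sum_congr rfl fun i _ => ?_
    have hpow : (P.u i : K) ^ n = u i ^ (n - r) * u i ^ r := by
      rw [← pow_add, Nat.sub_add_cancel hn]
    rw [hpow, hf, mul_neg, mul_neg, Finset.mul_sum, Finset.mul_sum]
    refine congrArg _ (Finset.sum_congr rfl fun j _ => ?_)
    rw [pow_add]
    ring

end GroundRing

/-! ### Localization and specialization inside a field -/

theorem map_gammaCoeff {r : ℕ} {K : Type v} [Field K] {L : Type w} [Field L] (f : K →+* L)
    (ρ q : K) (u : Fin r → K) (j : Fin r) :
    f (gammaCoeff ρ q u j) = gammaCoeff (f ρ) (f q) (fun i => f (u i)) j := by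
  simp only [gammaCoeff, map_mul, map_prod, map_div₀, map_sub, map_add, map_pow, map_one,
    map_inv₀, apply_ite f, map_neg]

/-- A power of `s` is a common denominator for each element of the closure; the rest takes place in
a field. -/
theorem Subring.isLocalization_away_of_le {K : Type v} [Field K] {A B : Subring K} (hAB : A ≤ B)
    (s : A) (hs : s ≠ 0) (hsB : (s : K)⁻¹ ∈ B)
    (hB : B ≤ Subring.closure ((A : Set K) ∪ {(s : K)⁻¹})) :
    let _ := (Subring.inclusion hAB).toAlgebra
    IsLocalization.Away s B := by
  let _ := (Subring.inclusion hAB).toAlgebra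
  have hs' : (s : K) ≠ 0 := fun h => hs (Subtype.ext h)
  have hcoe : ∀ a : A, ((algebraMap A B a : B) : K) = a := fun _ => rfl
  have hden : ∀ x ∈ Subring.closure ((A : Set K) ∪ {(s : K)⁻¹}), ∃ n : ℕ, x * (s : K) ^ n ∈ A := by
    intro x hx
    induction hx using Subring.closure_induction with
    | mem x hx =>
      rcases hx with hx | rfl
      · exact ⟨0, by simpa using hx⟩
      · exact ⟨1, by rw [pow_one, inv_mul_cancel₀ hs']; exact one_mem A⟩
    | zero => exact ⟨0, by simp⟩
    | one => exact ⟨0, by simp⟩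
    | add x y _ _ hx hy =>
      obtain ⟨m, hm⟩ := hx
      obtain ⟨n, hn⟩ := hy
      refine ⟨m + n, ?_⟩
      have : (x + y) * (s : K) ^ (m + n) =
          x * (s : K) ^ m * (s : K) ^ n + y * (s : K) ^ n * (s : K) ^ m := by ring
      rw [this]
      exact add_mem (mul_mem hm (pow_mem s.2 _)) (mul_mem hn (pow_mem s.2 _))
    | neg x _ hx =>
      obtain ⟨m, hm⟩ := hx
      exact ⟨m, by rw [neg_mul]; exact neg_mem hm⟩
    | mul x y _ _ hx hy =>
      obtain ⟨m, hm⟩ := hx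
      obtain ⟨n, hn⟩ := hy
      refine ⟨m + n, ?_⟩
      have : x * y * (s : K) ^ (m + n) = x * (s : K) ^ m * (y * (s : K) ^ n) := by ring
      rw [this]
      exact mul_mem hm hn
  refine { map_units := ?_, surj := ?_, exists_of_eq := ?_ }
  · rintro ⟨_, n, rfl⟩
    rw [map_pow]
    exact (IsUnit.of_mul_eq_one ⟨_, hsB⟩ (Subtype.ext (mul_inv_cancel₀ hs'))).pow n
  · intro z
    obtain ⟨n, hn⟩ := hden z (hB z.2)
    exact ⟨⟨⟨_, hn⟩, ⟨s ^ n, n, rfl⟩⟩, Subtype.ext rfl⟩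
  · intro x y hxy
    refine ⟨1, ?_⟩
    rw [show x = y from Subtype.ext (congrArg (fun b : B => (b : K)) hxy)]

namespace GroundRing

variable {r : ℕ}

theorem IsNormalized.map {S : Type v} [CommRing S] {T : Type w} [CommRing T] {P : GroundRing r S}
    (h : P.IsNormalized) (f : S →+* T) : (P.map f).IsNormalized := by
  have := congrArg (Units.map (f : S →* T)) h
  rw [IsNormalized]
  refine Eq.trans this ?_
  split_ifs <;> simp [GroundRing.map]

/-- If the images of the parameters of a generated ring lie in a subring, the homomorphism factors
through the subring. -/
theorem exists_map_eq_of_map_eq {R S T : Type*} [CommRing R] [CommRing S] [CommRing T]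
    {P : GroundRing r R} (hP : Subring.closure P.generators = ⊤) {Q : GroundRing r S}
    {f : R →+* T} {g : S →+* T} (hg : Function.Injective g) (h : P.map f = Q.map g) :
    ∃ ψ : R →+* S, P.map ψ = Q := by
  have hle : ∀ x, f x ∈ g.range := fun x => by
    have h1 : (⊤ : Subring R).map f ≤ g.range := by
      rw [← hP, RingHom.map_closure, ← generators_map, h, generators_map, Subring.closure_le]
      rintro _ ⟨y, _, rfl⟩
      exact ⟨y, rfl⟩
    exact h1 ⟨x, trivial, rfl⟩
  let e := RingEquiv.ofBijective g.rangeRestrict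
    ⟨fun x y hxy => hg (congrArg Subtype.val hxy), g.rangeRestrict_surjective⟩
  let ψ : R →+* S := (e.symm : g.range →+* S).comp (f.codRestrict g.range hle)
  have hψ : ∀ x, g (ψ x) = f x := fun x =>
    congrArg Subtype.val (e.apply_symm_apply (f.codRestrict g.range hle x))
  refine ⟨ψ, ext_of_coe (hg ?_) (hg ?_) (fun n => hg ?_) fun i => hg ?_⟩
  · rw [coe_map_ρ, hψ, ← coe_map_ρ, ← coe_map_ρ, h]
  · rw [coe_map_q, hψ, ← coe_map_q, ← coe_map_q, h]
  · rw [map_δ, hψ, ← map_δ, ← map_δ, h]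
  · rw [coe_map_u, hψ, ← coe_map_u, ← coe_map_u, h]

/-- Normalized parameters of a field specialize to those of another field along a homomorphism
from a local subring that is compatible with `q` and the `u i`. -/
theorem exists_map_restrict_eq {K : Type v} [Field K] {L : Type w} [Field L] {A : Subring K}
    {σ : A →+* L} (hσ : ∀ x, σ x ≠ 0 → IsUnit x) {P : GroundRing r K} (hP : P.Relations)
    (hPn : P.IsNormalized) {Q : GroundRing r L} (hQ : Q.Relations) (hQn : Q.IsNormalized)
    (hQq : Q.qDiff ≠ 0) {q : A} (hqP : (q : K) = P.q) (hqQ : σ q = Q.q)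
    {u : Fin r → A} (huP : ∀ i, (u i : K) = P.u i) (huQ : ∀ i, σ (u i) = Q.u i) :
    ∃ hA : P.generators ⊆ A, (P.restrict A hP hA).map σ = Q := by
  have hq0 : σ q ≠ 0 := by rw [hqQ]; exact Q.q.ne_zero
  have hu0 : ∀ i, σ (u i) ≠ 0 := fun i => by rw [huQ]; exact (Q.u i).ne_zero
  obtain ⟨qA, rfl⟩ := hσ q hq0
  choose uA huA using fun i => hσ (u i) (hu0 i)
  simp only [← huA] at huP huQ
  -- Both families are normalized, so this one expression in `A` has the two values of `ρ` as its
  -- images.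
  set ρA : Aˣ := if Odd r then ∏ i, uA i else qA⁻¹ * ∏ i, uA i with hρA
  have eqP : Units.map (A.subtype : A →* K) qA = P.q := Units.ext hqP
  have eqQ : Units.map (σ : A →* L) qA = Q.q := Units.ext hqQ
  have euP : ∀ i, Units.map (A.subtype : A →* K) (uA i) = P.u i := fun i => Units.ext (huP i)
  have euQ : ∀ i, Units.map (σ : A →* L) (uA i) = Q.u i := fun i => Units.ext (huQ i)
  have eρP : Units.map (A.subtype : A →* K) ρA = P.ρ := by
    rw [hPn, hρA]
    split_ifs <;> simp [eqP, euP]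
  have eρQ : Units.map (σ : A →* L) ρA = Q.ρ := by
    rw [hQn, hρA]
    split_ifs <;> simp [eqQ, euQ]
  have hqd : σ ((qA : A) - (↑qA⁻¹ : A)) = Q.qDiff := by
    rw [map_sub, qDiff, ← eqQ]; rfl
  obtain ⟨t, ht⟩ := (hσ _ (by rw [hqd]; exact hQq)).exists_left_inv
  have htP : (t : K) * P.qDiff = 1 := by
    have := congrArg A.subtype ht
    rw [qDiff, ← eqP]
    exact this
  have hmem : ∀ (x : Aˣ) (y : Kˣ), Units.map (A.subtype : A →* K) x = y →
      (y : K) ∈ A ∧ (↑y⁻¹ : K) ∈ A := by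
    rintro x _ rfl
    exact ⟨(x : A).2, (↑x⁻¹ : A).2⟩
  have hρm := hmem _ _ eρP
  have hδ := hP.delta_mem hρm.1 hρm.2 (fun i => (hmem _ _ (euP i)).1)
    (fun i => (hmem _ _ (euP i)).2) t.2 htP
  have htQ : σ t * Q.qDiff = 1 := by rw [← hqd, ← map_mul, ht, map_one]
  have hδ0 : σ ⟨P.δ 0, hδ 0⟩ = Q.δ 0 := by
    have h1 : (⟨P.δ 0, hδ 0⟩ : A) = 1 - t * ((↑ρA⁻¹ : A) - ρA) :=
      Subtype.ext ((P.delta_zero_eq htP).trans (by rw [← eρP]; rfl))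
    rw [h1, Q.delta_zero_eq htQ, ← eρQ]
    simp
  -- Since `δ 0` is non-zero in the target, it is already a unit of `A`.
  obtain ⟨d, hd⟩ := (hσ ⟨P.δ 0, hδ 0⟩ (by rw [hδ0]; exact Q.isUnit_δ_zero.ne_zero))
  have hA : P.generators ⊆ A := by
    refine (P.generators_subset_iff A).2
      ⟨⟨(hmem _ _ eqP).1, (hmem _ _ eqP).2, hρm.1, hρm.2, (hmem d _ ?_).2⟩, fun j _ => hδ j,
        fun i => hmem _ _ (euP i)⟩
    exact Units.ext (congrArg Subtype.val hd)
  refine ⟨hA, Relations.eq_of_eq ((relations_restrict hP hA).map σ) hQ ?_ ?_ ?_ ?_⟩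
  · rw [← eρQ]
    refine Units.ext (congrArg σ (Subtype.ext ?_))
    exact congrArg Units.val eρP.symm
  · rw [← eqQ]
    refine Units.ext (congrArg σ (Subtype.ext ?_))
    exact congrArg Units.val eqP.symm
  · funext i
    rw [← euQ]
    refine Units.ext (congrArg σ (Subtype.ext ?_))
    exact congrArg Units.val (euP i).symm
  · have : (P.restrict A hP hA).qDiff = (qA : A) - (↑qA⁻¹ : A) := Subtype.ext (by
      change (P.q : K) - (↑P.q⁻¹ : K) = _
      rw [← eqP]
      rfl)
    rw [map_qDiff, this, hqd]
    exact isUnit_iff_ne_zero.2 hQq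

theorem isUAdmissible_restrict {K : Type v} [Field K] {A : Subring K} {P : GroundRing r K}
    (hP : P.Relations) (hA : P.generators ⊆ A) (hq : P.qDiff ≠ 0) (hu : Function.Injective P.u)
    (hu1 : ∀ i j, P.u i * P.u j ≠ 1)
    (hδ : ∀ n, P.δ n = ∑ i, gammaCoeff (P.ρ : K) P.q (fun i => (P.u i : K)) i * (P.u i : K) ^ n) :
    (P.restrict A hP hA).IsUAdmissible where
  qDiff_ne_zero h := hq (congrArg Subtype.val h)
  u_injective i j h := hu (Units.ext (congrArg (fun x : Aˣ => ((x : A) : K)) h))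
  u_mul_ne_one i j h := hu1 i j (Units.ext (congrArg (fun x : Aˣ => ((x : A) : K)) h))
  delta_eq n := by
    -- The formula for `δ n` lives in the fraction field of `A`, which embeds in `K`, where it is
    -- known.
    let f : FractionRing A →+* K := IsFractionRing.lift A.subtype_injective
    have hf : ∀ x : A, f (algebraMap A (FractionRing A) x) = x := fun x =>
      IsFractionRing.lift_algebraMap _ x
    apply f.injective
    simp only [map_sum, map_mul, map_pow, map_gammaCoeff, hf]
    exact hδ n

end GroundRing

/-! ### The universal admissible ring `R₀` -/

/-- Names for the parameters of a ground ring and their inverses. -/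
inductive AdmissibleVar (r : ℕ) : Type
  | q | qInv | ρ | ρInv | δInv
  | δ (n : ℕ)
  | u (i : Fin r)
  | uInv (i : Fin r)

/-- Names for the relations between the parameters of an admissible ring. -/
inductive AdmissibleRel (r : ℕ) : Type
  | q | ρ | δ
  | u (i : Fin r)
  | ground
  | ell (l : ℕ) (h1 : 1 ≤ l) (h2 : l ≤ r - 1)
  | rho
  | delta (n : ℕ) (h : r ≤ n)

namespace AdmissibleVar

variable {r : ℕ} {S : Type v} [CommRing S] {T : Type w} [CommRing T]

/-- The signed elementary symmetric functions of the values of the variables `u i`. -/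
def a (c : AdmissibleVar r → S) (j : ℕ) : S :=
  (-1) ^ (r - j) * ∑ t ∈ Finset.powersetCard (r - j) (Finset.univ : Finset (Fin r)),
    ∏ i ∈ t, c (.u i)

/-- The inverse of `a 0`. -/
def aZeroInv (c : AdmissibleVar r → S) : S := (-1) ^ r * ∏ i, c (.uInv i)

/-- The elements that vanish when the values of the variables are parameters of an admissible
ring. -/
def relator (c : AdmissibleVar r → S) : AdmissibleRel r → S
  | .q => c q * c qInv - 1
  | .ρ => c ρ * c ρInv - 1
  | .δ => c (δ 0) * c δInv - 1
  | .u i => c (u i) * c (uInv i) - 1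
  | .ground => (c ρInv - c ρ) - (c qInv - c q) * (c (δ 0) - 1)
  | .ell l _ _ => c ρ * (a c l - a c (r - l) * aZeroInv c) + (c q - c qInv) *
        ((∑ j ∈ Finset.Icc 1 (r - l), a c (j + l) * c (δ j))
          - (∑ j ∈ Finset.Icc (max (l + 1) ((r + 1) / 2)) ((l + r) / 2), a c (2 * j - l))
          + ∑ j ∈ Finset.Icc ((l + 1) / 2) (min l ((r + 1) / 2 - 1)), a c (2 * j - l))
  | .rho => c ρInv * a c 0 - c ρ * aZeroInv c - if Odd r then 0 else (c q - c qInv)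
  | .delta n _ => c (δ n) - -∑ j ∈ Finset.range r, a c j * c (δ (n - r + j))

theorem map_relator (f : S →+* T) (c : AdmissibleVar r → S) (i : AdmissibleRel r) :
    f (relator c i) = relator (fun x => f (c x)) i := by
  cases i <;> simp [relator, a, aZeroInv, apply_ite f]

/-- Values of the variables that satisfy the relations are parameters of a ground ring. -/
def groundRing (c : AdmissibleVar r → S) (h : ∀ i, relator c i = 0) : GroundRing r S where
  ρ := ⟨c ρ, c ρInv, sub_eq_zero.1 (h .ρ), (mul_comm _ _).trans (sub_eq_zero.1 (h .ρ))⟩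
  q := ⟨c q, c qInv, sub_eq_zero.1 (h .q), (mul_comm _ _).trans (sub_eq_zero.1 (h .q))⟩
  δ n := c (δ n)
  u i := ⟨c (u i), c (uInv i), sub_eq_zero.1 (h (.u i)),
    (mul_comm _ _).trans (sub_eq_zero.1 (h (.u i)))⟩
  isUnit_δ_zero := .of_mul_eq_one _ (sub_eq_zero.1 (h .δ))
  rel := sub_eq_zero.1 (h .ground)

theorem groundRing_relations (c : AdmissibleVar r → S) (h : ∀ i, relator c i = 0) :
    (groundRing c h).Relations := by
  have h0 : (↑(groundRing c h).aZero⁻¹ : S) = aZeroInv c := GroundRing.coe_aZero_inv _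
  refine ⟨fun l h1 h2 => ?_, ?_, fun n hn => ?_⟩
  · rw [h0]
    exact h (.ell l h1 h2)
  · rw [h0]
    exact sub_eq_zero.1 (h .rho)
  · exact sub_eq_zero.1 (h (.delta n hn))

end AdmissibleVar

namespace GroundRing

open AdmissibleVar

variable {r : ℕ} {S : Type v} [CommRing S]

/-- The values of the variables given by the parameters of a ground ring. -/
noncomputable def value (P : GroundRing r S) : AdmissibleVar r → S
  | .q => P.q
  | .qInv => (↑P.q⁻¹ : S)
  | .ρ => P.ρ
  | .ρInv => (↑P.ρ⁻¹ : S)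
  | .δInv => (↑P.isUnit_δ_zero.unit⁻¹ : S)
  | .δ n => P.δ n
  | .u i => P.u i
  | .uInv i => (↑(P.u i)⁻¹ : S)

theorem Relations.relator_value {P : GroundRing r S} (h : P.Relations) (i : AdmissibleRel r) :
    relator P.value i = 0 := by
  have h0 : aZeroInv P.value = (↑P.aZero⁻¹ : S) := (coe_aZero_inv P).symm
  cases i with
  | q => exact sub_eq_zero.2 P.q.mul_inv
  | ρ => exact sub_eq_zero.2 P.ρ.mul_inv
  | δ => exact sub_eq_zero.2 P.isUnit_δ_zero.mul_val_inv
  | u i => exact sub_eq_zero.2 (P.u i).mul_inv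
  | ground => exact sub_eq_zero.2 P.rel
  | ell l h1 h2 =>
    rw [relator, h0]
    exact h.rel_ell l h1 h2
  | rho =>
    rw [relator, h0]
    exact sub_eq_zero.2 h.rel_rho
  | delta n hn => exact sub_eq_zero.2 (h.rel_delta n hn)

end GroundRing

namespace UniversalAdmissible

open MvPolynomial AdmissibleVar

/-- The polynomial ring in the parameters modulo the admissibility relations. -/
abbrev QuotientRing (r : ℕ) : Type :=
  MvPolynomial (AdmissibleVar r) ℤ ⧸
    Ideal.span (Set.range (relator (X : AdmissibleVar r → MvPolynomial (AdmissibleVar r) ℤ)))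

theorem relator_mk_X (r : ℕ) (i : AdmissibleRel r) :
    relator (fun x => (Ideal.Quotient.mk _ (X x) : QuotientRing r)) i = 0 := by
  rw [← map_relator]
  exact Ideal.Quotient.eq_zero_iff_mem.2 (Ideal.subset_span ⟨i, rfl⟩)

/-- The universal parameters that satisfy the admissibility relations. -/
noncomputable def quotientParameters (r : ℕ) : GroundRing r (QuotientRing r) :=
  groundRing _ (relator_mk_X r)

theorem quotientParameters_relations (r : ℕ) : (quotientParameters r).Relations :=
  groundRing_relations _ _

theorem exists_map_quotientParameters {r : ℕ} {S : Type v} [CommRing S] {P : GroundRing r S}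
    (h : P.Relations) : ∃ f : QuotientRing r →+* S, (quotientParameters r).map f = P := by
  have hg : ∀ x, eval₂Hom (Int.castRingHom S) P.value (X x) = P.value x := fun x =>
    eval₂Hom_X' _ _ _
  refine ⟨Ideal.Quotient.lift _ (eval₂Hom (Int.castRingHom S) P.value) fun x hx => ?_, ?_⟩
  · refine (Ideal.span_le (I := RingHom.ker (eval₂Hom (Int.castRingHom S) P.value))).2 ?_ hx
    rintro _ ⟨i, rfl⟩
    refine (map_relator _ _ i).trans ?_
    simp only [hg]
    exact h.relator_value i
  · exact GroundRing.ext_of_coe (hg _) (hg _) (fun n => hg (.δ n)) fun i => hg (.u i)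

/-- The universal parameters with `q - q⁻¹` invertible. -/
noncomputable def localParameters (r : ℕ) :
    GroundRing r (Localization.Away (quotientParameters r).qDiff) :=
  (quotientParameters r).map (algebraMap _ _)

theorem localParameters_relations (r : ℕ) : (localParameters r).Relations :=
  (quotientParameters_relations r).map _

/-- The universal admissible ring. -/
noncomputable abbrev ring (r : ℕ) : Subring (Localization.Away (quotientParameters r).qDiff) :=
  Subring.closure (localParameters r).generators

/-- The parameters of the universal admissible ring. -/
noncomputable def parameters (r : ℕ) : GroundRing r (ring r) :=
  (localParameters r).restrict (ring r) (localParameters_relations r) Subring.subset_closure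

theorem parameters_relations (r : ℕ) : (parameters r).Relations :=
  GroundRing.relations_restrict _ _

theorem closure_generators (r : ℕ) : Subring.closure (parameters r).generators = ⊤ :=
  GroundRing.closure_generators_restrict _ _ rfl

/-- Since `q - q⁻¹` is not a zero-divisor, `S` embeds in its localization. The map between
localizations sends the generators of `ring r` to elements of `S`, hence all of `ring r` into `S`.
-/
theorem exists_map_parameters {r : ℕ} {S : Type v} [CommRing S] {P : GroundRing r S}
    (h : P.IsAdmissible) : ∃ f : ring r →+* S, (parameters r).map f = P := by
  obtain ⟨f, hf⟩ := exists_map_quotientParameters h.relations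
  have hu : IsUnit ((algebraMap S (Localization.Away P.qDiff)).comp f
      (quotientParameters r).qDiff) := by
    rw [RingHom.comp_apply, ← GroundRing.map_qDiff, hf]
    exact IsLocalization.Away.algebraMap_isUnit _
  have hinj : Function.Injective (algebraMap S (Localization.Away P.qDiff)) :=
    IsLocalization.injective _ (Submonoid.powers_le.2 h.qDiff_mem)
  let g : Localization.Away (quotientParameters r).qDiff →+* Localization.Away P.qDiff :=
    IsLocalization.Away.lift (quotientParameters r).qDiff hu
  have hg : ∀ x, g (algebraMap _ _ x) = algebraMap _ _ (f x) := fun x =>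
    IsLocalization.Away.lift_eq _ hu x
  refine GroundRing.exists_map_eq_of_map_eq (f := g.comp (ring r).subtype)
    (closure_generators r) hinj ?_
  refine Eq.trans ?_ (congrArg (fun Q => Q.map (algebraMap S (Localization.Away P.qDiff))) hf)
  exact GroundRing.ext_of_coe (hg _) (hg _) (fun n => hg _) fun i => hg _

theorem qDiff_mem_nonZeroDivisors (r : ℕ) :
    (parameters r).qDiff ∈ nonZeroDivisors (ring r) := by
  have h : IsUnit (localParameters r).qDiff := by
    rw [localParameters, GroundRing.map_qDiff]
    exact IsLocalization.Away.algebraMap_isUnit _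
  refine mem_nonZeroDivisors_iff_right.2 fun x hx => Subtype.ext ?_
  have hx' : (x : Localization.Away (quotientParameters r).qDiff) * (localParameters r).qDiff = 0 :=
    congrArg Subtype.val hx
  exact h.mul_left_eq_zero.1 hx'

end UniversalAdmissible

/-! ### The universal admissible domain `R₊` and the universal `u`-admissible ring -/

/-- Parameters whose images are the images of the indeterminates under an injective homomorphism
are algebraically independent. -/
theorem GroundRing.algIndep_of_comp_eq {r : ℕ} {S : Type v} [CommRing S] {T : Type w} [CommRing T]
    {P : GroundRing r S} {F : MvPolynomial (Option (Fin r)) ℤ →+* T} (hF : Function.Injective F)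
    (g : S →+* T)
    (h : ∀ i : Option (Fin r), g (i.elim (P.q : S) fun i => (P.u i : S)) = F (.X i)) :
    P.AlgIndep := by
  refine algebraicIndependent_iff_injective_aeval.2 ?_
  have hcomp : g.comp (MvPolynomial.aeval (R := ℤ)
      fun i : Option (Fin r) => i.elim (P.q : S) fun i => (P.u i : S)).toRingHom = F :=
    MvPolynomial.ringHom_ext (by simp) fun i => by simpa using h i
  exact Function.Injective.of_comp (f := g) (by
    have := hF
    rw [← hcomp] at this
    exact this)

namespace UniversalU

open MvPolynomial GroundRing

theorem algebraMap_injective (r : ℕ) : Function.Injective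
    (algebraMap (MvPolynomial (Option (Fin r)) ℤ) (RatField r)) :=
  IsFractionRing.injective _ _

/-- A polynomial expression in the indeterminates with a non-zero value is non-zero. -/
theorem algebraMap_ne_zero_of_eval {r : ℕ} {F : MvPolynomial (Option (Fin r)) ℤ}
    (x : Option (Fin r) → ℤ) (h : eval x F ≠ 0) :
    algebraMap (MvPolynomial (Option (Fin r)) ℤ) (RatField r) F ≠ 0 := fun h0 => h (by
  rw [(map_eq_zero_iff _ (algebraMap_injective r)).1 h0, map_zero])

theorem q_ne_zero (r : ℕ) : q r ≠ 0 :=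
  algebraMap_ne_zero_of_eval (fun _ => 1) (by simp)

theorem u_ne_zero (r : ℕ) (i : Fin r) : u r i ≠ 0 :=
  algebraMap_ne_zero_of_eval (fun _ => 1) (by simp)

theorem q_inv_sub_q_ne_zero (r : ℕ) : (q r)⁻¹ - q r ≠ 0 := by
  intro h
  have hq := q_ne_zero r
  have h1 : algebraMap _ (RatField r) (1 - X none * X none : MvPolynomial (Option (Fin r)) ℤ) ≠ 0 :=
    algebraMap_ne_zero_of_eval (fun _ => 2) (by simp)
  refine h1 ?_
  rw [map_sub, map_one, map_mul]
  change 1 - q r * q r = 0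
  field_simp at h
  linear_combination h

theorem u_mul_u_ne_one (r : ℕ) (i j : Fin r) : u r i * u r j ≠ 1 := by
  have h1 : algebraMap _ (RatField r)
      (X (some i) * X (some j) - 1 : MvPolynomial (Option (Fin r)) ℤ) ≠ 0 :=
    algebraMap_ne_zero_of_eval (fun _ => 2) (by simp)
  rw [map_sub, map_one, map_mul] at h1
  exact sub_ne_zero.1 h1

theorem u_injective (r : ℕ) : Function.Injective (u r) := fun _ _ h =>
  Option.some_injective _ (X_injective (algebraMap_injective r h))

theorem rel_rho_delta {r : ℕ} (hr : 1 ≤ r) :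
    (ρ r)⁻¹ - ρ r = ((q r)⁻¹ - q r) * (δ r 0 - 1) := by
  have h := rel_of_gammaCoeff hr (u_injective r) (u_ne_zero r) (fun i => u_mul_u_ne_one r i i)
    (q_ne_zero r) (q_inv_sub_q_ne_zero r) (ρ := ρ r) rfl
  rw [h, δ]
  simp

theorem rho_ne_zero (r : ℕ) : ρ r ≠ 0 := by
  have hp : ∏ i, u r i ≠ 0 := Finset.prod_ne_zero_iff.2 fun i _ => u_ne_zero r i
  rw [ρ]
  split_ifs
  exacts [hp, mul_ne_zero (inv_ne_zero (q_ne_zero r)) hp]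

/-- If `δ 0 = 0`, the ground relation becomes a polynomial identity between `q` and `p = ∏ i, u i`,
which fails at `q = 1`, `p = 2`. -/
theorem delta_zero_ne_zero {r : ℕ} (hr : 1 ≤ r) : δ r 0 ≠ 0 := by
  intro h0
  have h := rel_rho_delta hr
  rw [h0] at h
  have hq := q_ne_zero r
  have hp : ∏ i, u r i ≠ 0 := Finset.prod_ne_zero_iff.2 fun i _ => u_ne_zero r i
  let x : Option (Fin r) → ℤ := fun i => i.elim 1 fun i => if i = ⟨0, hr⟩ then 2 else 1
  have hx : ∏ i : Fin r, (if i = ⟨0, hr⟩ then 2 else 1 : ℤ) = 2 := by simp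
  let p : MvPolynomial (Option (Fin r)) ℤ := ∏ i, X (some i)
  have hpu : algebraMap _ (RatField r) p = ∏ i, u r i := map_prod _ _ _
  have hqX : algebraMap _ (RatField r) (X none : MvPolynomial (Option (Fin r)) ℤ) = q r := rfl
  rw [ρ] at h
  split_ifs at h
  · refine algebraMap_ne_zero_of_eval (r := r)
      (F := X none - p ^ 2 * X none + p - p * X none ^ 2) x ?_ ?_
    · simp [p, x, map_prod, hx]
    · simp only [map_sub, map_add, map_mul, map_pow, hpu, hqX]
      field_simp at h
      linear_combination h
  · refine algebraMap_ne_zero_of_eval (r := r)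
      (F := X none ^ 2 - p ^ 2 + p - p * X none ^ 2) x ?_ ?_
    · simp [p, x, map_prod, hx]
    · simp only [map_sub, map_add, map_mul, map_pow, hpu, hqX]
      field_simp at h
      linear_combination h

/-- The parameters of the field `ℚ(q, u 1, …, u r)`. -/
noncomputable def fieldParameters {r : ℕ} (hr : 1 ≤ r) : GroundRing r (RatField r) where
  ρ := Units.mk0 (ρ r) (rho_ne_zero r)
  q := Units.mk0 (q r) (q_ne_zero r)
  δ := δ r
  u i := Units.mk0 (u r i) (u_ne_zero r i)
  isUnit_δ_zero := isUnit_iff_ne_zero.2 (delta_zero_ne_zero hr)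
  rel := by simpa using rel_rho_delta hr

variable {r : ℕ} (hr : 1 ≤ r)

theorem fieldParameters_isNormalized : (fieldParameters hr).IsNormalized := by
  refine Units.ext ?_
  change ρ r = _
  rw [ρ]
  split_ifs <;> simp [fieldParameters]

theorem fieldParameters_u_injective : Function.Injective (fieldParameters hr).u := fun _ _ h =>
  u_injective r (congrArg Units.val h)

theorem fieldParameters_u_mul_ne_one (i j : Fin r) :
    (fieldParameters hr).u i * (fieldParameters hr).u j ≠ 1 := fun h =>
  u_mul_u_ne_one r i j (congrArg Units.val h)

theorem fieldParameters_qDiff : (fieldParameters hr).qDiff = -((q r)⁻¹ - q r) := by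
  simp [qDiff, fieldParameters]

theorem fieldParameters_qDiff_ne_zero : (fieldParameters hr).qDiff ≠ 0 := by
  rw [fieldParameters_qDiff]
  exact neg_ne_zero.2 (q_inv_sub_q_ne_zero r)

theorem fieldParameters_relations : (fieldParameters hr).Relations :=
  relations_of_gammaCoeff hr (fieldParameters_u_injective hr)
    (fun i => fieldParameters_u_mul_ne_one hr i i) (fieldParameters_qDiff_ne_zero hr)
    (fieldParameters_isNormalized hr) fun _ => rfl

/-- For the `δ j` this uses the recursion, whose only denominator `q - q⁻¹` is invertible in `ring
r`. -/
theorem generators_subset_ring : (fieldParameters hr).generators ⊆ ring r := by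
  have hq : q r ∈ ring r := Subring.subset_closure (by simp)
  have hq' : (q r)⁻¹ ∈ ring r := Subring.subset_closure (by simp)
  have hz : ((q r)⁻¹ - q r)⁻¹ ∈ ring r := Subring.subset_closure (by simp)
  have hd : (δ r 0)⁻¹ ∈ ring r := Subring.subset_closure (by simp)
  have hu : ∀ i, u r i ∈ ring r := fun i => Subring.subset_closure (.inr ⟨i, .inl rfl⟩)
  have hu' : ∀ i, (u r i)⁻¹ ∈ ring r := fun i => Subring.subset_closure (.inr ⟨i, .inr rfl⟩)
  have hρ : ρ r ∈ ring r := by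
    rw [ρ]
    split_ifs
    exacts [prod_mem fun i _ => hu i, mul_mem hq' (prod_mem fun i _ => hu i)]
  have hρ' : (ρ r)⁻¹ ∈ ring r := by
    rw [ρ]
    split_ifs
    · rw [← Finset.prod_inv_distrib]
      exact prod_mem fun i _ => hu' i
    · rw [mul_inv, inv_inv, ← Finset.prod_inv_distrib]
      exact mul_mem hq (prod_mem fun i _ => hu' i)
  have hinv : ∀ x : (RatField r)ˣ, (x : RatField r)⁻¹ ∈ ring r → (↑x⁻¹ : RatField r) ∈ ring r :=
    fun x hx => by rwa [Units.val_inv_eq_inv_val]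
  refine (generators_subset_iff _ _).2 ⟨⟨hq, hinv _ hq', hρ, hinv _ hρ', hinv _ hd⟩,
    fun j _ => ?_, fun i => ⟨hu i, hinv _ (hu' i)⟩⟩
  refine (fieldParameters_relations hr).delta_mem hρ (hinv _ hρ') hu (fun i => hinv _ (hu' i))
    (neg_mem hz) ?_ j
  rw [fieldParameters_qDiff, neg_mul_neg, inv_mul_cancel₀ (q_inv_sub_q_ne_zero r)]

/-- The parameters of the universal `u`-admissible ring. -/
noncomputable def parameters : GroundRing r (ring r) :=
  (fieldParameters hr).restrict (ring r) (fieldParameters_relations hr) (generators_subset_ring hr)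

theorem isParameters_parameters : IsParameters (parameters hr) :=
  ⟨rfl, rfl, fun _ => rfl, fun _ => rfl⟩

theorem isUAdmissible_parameters : (parameters hr).IsUAdmissible :=
  isUAdmissible_restrict _ _ (fieldParameters_qDiff_ne_zero hr) (fieldParameters_u_injective hr)
    (fieldParameters_u_mul_ne_one hr) fun _ => rfl

/-- The universal admissible integral domain. -/
noncomputable abbrev integralRing : Subring (RatField r) :=
  Subring.closure (fieldParameters hr).generators

/-- The parameters of the universal admissible integral domain. -/
noncomputable def integralParameters : GroundRing r (integralRing hr) :=
  (fieldParameters hr).restrict _ (fieldParameters_relations hr) Subring.subset_closure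

theorem closure_generators_integralParameters :
    Subring.closure (integralParameters hr).generators = ⊤ :=
  closure_generators_restrict _ _ rfl

theorem integralParameters_qDiff_ne_zero : (integralParameters hr).qDiff ≠ 0 := fun h =>
  fieldParameters_qDiff_ne_zero hr (congrArg Subtype.val h)

theorem integralParameters_isAdmissible : (integralParameters hr).IsAdmissible :=
  (relations_restrict _ _).isAdmissible (integralParameters_qDiff_ne_zero hr)
    (mem_nonZeroDivisors_of_ne_zero (integralParameters_qDiff_ne_zero hr))

theorem algIndep_integralParameters : (integralParameters hr).AlgIndep :=
  algIndep_of_comp_eq (algebraMap_injective r) (integralRing hr).subtype fun i => by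
    cases i <;> rfl

theorem integralRing_le : integralRing hr ≤ ring r :=
  Subring.closure_le.2 (generators_subset_ring hr)

/-- Both rings lie in one field, and apart from `(q⁻¹ - q)⁻¹` the generators of `ring r` already
belong to `integralRing hr`. -/
theorem exists_ringEquiv_localization :
    ∃ e : Localization.Away (integralParameters hr).qDiff ≃+* ring r,
      (integralParameters hr).localized.map
        (e : Localization.Away (integralParameters hr).qDiff →+* ring r) = parameters hr := by
  let _ := (Subring.inclusion (integralRing_le hr)).toAlgebra
  have hq : (((integralParameters hr).qDiff : integralRing hr) : RatField r)⁻¹ =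
      -((q r)⁻¹ - q r)⁻¹ := by
    rw [← inv_neg, ← fieldParameters_qDiff hr]
    rfl
  have hmem : ∀ x ∈ (fieldParameters hr).generators, x ∈ integralRing hr := fun x hx =>
    Subring.subset_closure hx
  have hz : ((q r)⁻¹ - q r)⁻¹ ∈ ring r := Subring.subset_closure (by simp)
  obtain ⟨⟨g1, g2, -, -, g5⟩, -, gu⟩ :=
    (generators_subset_iff _ (integralRing hr)).1 Subring.subset_closure
  rw [Units.val_inv_eq_inv_val] at g2 g5
  have hloc : IsLocalization.Away (integralParameters hr).qDiff (ring r) := by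
    refine Subring.isLocalization_away_of_le (integralRing_le hr) _
      (integralParameters_qDiff_ne_zero hr) (by rw [hq]; exact neg_mem hz) ?_
    rw [hq]
    have hsub : ∀ x ∈ integralRing hr, x ∈ Subring.closure
        ((integralRing hr : Set (RatField r)) ∪ {-((q r)⁻¹ - q r)⁻¹}) := fun x hx =>
      Subring.subset_closure (.inl hx)
    refine Subring.closure_le.2 ?_
    rintro x ((rfl | rfl | rfl | rfl) | ⟨i, rfl | rfl⟩)
    · exact hsub _ g1
    · exact hsub _ g2
    · exact neg_mem_iff.1 (Subring.subset_closure (.inr rfl))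
    · exact hsub _ g5
    · exact hsub _ (gu i).1
    · have := (gu i).2
      rw [Units.val_inv_eq_inv_val] at this
      exact hsub _ this
  let e := IsLocalization.algEquiv (Submonoid.powers (integralParameters hr).qDiff)
    (Localization.Away (integralParameters hr).qDiff) (ring r)
  have he : ∀ x, e (algebraMap _ _ x) = Subring.inclusion (integralRing_le hr) x := fun x =>
    e.commutes x
  exact ⟨e.toRingEquiv, ext_of_coe (he _) (he _) (fun n => he _) fun i => he _⟩

/-- The kernel of `θ` may be non-zero, so `θ` does not extend to the whole field. It extends to the
localization `A` at its kernel, where everything with non-zero image is a unit; this suffices for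
all parameters to lie in `A`. Their images lie in `S`, so the values do as well. -/
theorem exists_map_integralParameters {S : Type v} [CommRing S] [IsDomain S]
    {P : GroundRing r S} (h : P.IsAdmissible) (hn : P.IsNormalized) :
    ∃ ψ : integralRing hr →+* S, (integralParameters hr).map ψ = P := by
  let L := FractionRing S
  have hinj : Function.Injective (algebraMap S L) := IsFractionRing.injective _ _
  let θ : MvPolynomial (Option (Fin r)) ℤ →+* L := eval₂Hom (Int.castRingHom L)
    fun i => i.elim (algebraMap S L P.q) fun i => algebraMap S L (P.u i)
  have hθ : ∀ i, θ (X i) = i.elim (algebraMap S L P.q) fun i => algebraMap S L (P.u i) :=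
    fun i => eval₂Hom_X' _ _ _
  have hprime : (RingHom.ker θ).IsPrime := RingHom.ker_isPrime θ
  let M := (RingHom.ker θ).primeCompl
  have hM0 : ∀ {x}, x ∈ M ↔ θ x ≠ 0 := Iff.rfl
  have hM : M ≤ nonZeroDivisors _ := le_nonZeroDivisors_of_noZeroDivisors fun h0 =>
    hM0.1 h0 (map_zero θ)
  let A := Localization.subalgebra.ofField (RatField r) M hM
  let σ : A →+* L := IsLocalization.lift (M := M) (g := θ) fun y => isUnit_iff_ne_zero.2 (hM0.1 y.2)
  have hσ : ∀ x, σ (algebraMap _ A x) = θ x := fun x => IsLocalization.lift_eq _ x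
  have hunit : ∀ x : A.toSubring, σ x ≠ 0 → IsUnit x := by
    rintro ⟨x, hx⟩ h0
    obtain ⟨⟨a, s⟩, has⟩ := IsLocalization.surj M (⟨x, hx⟩ : A)
    have h1 : σ (⟨x, hx⟩ : A) * θ s = θ a := by rw [← hσ, ← hσ, ← map_mul, has]
    have ha : a ∈ M := hM0.2 (h1 ▸ mul_ne_zero h0 (hM0.1 s.2))
    have h2 : IsUnit (algebraMap _ A a) := IsLocalization.map_units A ⟨a, ha⟩
    rw [← has] at h2
    exact isUnit_of_mul_isUnit_left h2
  obtain ⟨hA, hmap⟩ := exists_map_restrict_eq (A := A.toSubring) (σ := σ) hunit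
    (fieldParameters_relations hr) (fieldParameters_isNormalized hr)
    (h.relations.map (algebraMap S L)) (hn.map _)
    (by rw [map_qDiff]; exact (map_ne_zero_iff _ hinj).2 h.qDiff_ne_zero)
    (q := algebraMap _ A (X none)) rfl ((hσ _).trans (hθ none))
    (u := fun i => algebraMap _ A (X (some i))) (fun _ => rfl) fun i => (hσ _).trans (hθ (some i))
  refine exists_map_eq_of_map_eq (f := σ.comp (Subring.inclusion (Subring.closure_le.2 hA)))
    (closure_generators_integralParameters hr) hinj ?_
  rw [← hmap]
  rfl

end UniversalU

/-! ### Assembly of the universal properties -/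

theorem GroundRing.IsMorphism.comp_map {r : ℕ} {R S T : Type*} [CommRing R] [CommRing S]
    [CommRing T] {P : GroundRing r R} {Q : GroundRing r S} {P' : GroundRing r T} {π : R →+* S}
    {ψ : S →+* T} (hπ : P.map π = Q) (hψ : Q.IsMorphism P' ψ) :
    P.IsMorphism P' (ψ.comp π) := by
  subst hπ
  exact hψ

open UniversalU in
theorem mainTheorem5 (r : ℕ) (hr : 1 ≤ r) :
    ∃ (R₀ Rp : Type) (_ : CommRing R₀) (_ : CommRing Rp) (_ : IsDomain Rp)
      (P₀ : GroundRing r R₀) (Pp : GroundRing r Rp) (π : R₀ →+* Rp),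
      -- both rings are admissible, and there is a morphism of ground rings between them
      P₀.IsAdmissible ∧ Pp.IsAdmissible ∧ P₀.IsMorphism Pp π ∧
      -- they are generated by the parameters
      Subring.closure P₀.generators = ⊤ ∧ Subring.closure Pp.generators = ⊤ ∧
      -- algebraic independence of `q, u 1, …, u r`
      Pp.AlgIndep ∧ P₀.AlgIndep ∧
      -- universality, with factorization for integral domains
      (∀ (S : Type v) [CommRing S] (P : GroundRing r S), P.IsAdmissible →
        ∃ φ : R₀ →+* S, P₀.IsMorphism P φ) ∧
      (∀ (S : Type v) [CommRing S] [IsDomain S] (P : GroundRing r S), P.IsAdmissible →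
        ∃ (φ : R₀ →+* S) (ψ : Rp →+* S),
          P₀.IsMorphism P φ ∧ Pp.IsMorphism P ψ ∧ φ = ψ.comp π) ∧
      -- the localization at `q - q⁻¹` is the universal `u`-admissible ring
      ∃ PU : GroundRing r (UniversalU.ring r), UniversalU.IsParameters PU ∧ PU.IsUAdmissible ∧
        ∃ e : Localization.Away Pp.qDiff ≃+* UniversalU.ring r,
          Pp.localized.IsMorphism PU (e : Localization.Away Pp.qDiff →+* UniversalU.ring r) := by
  have hp := integralParameters_isAdmissible hr
  obtain ⟨π, hπ⟩ := UniversalAdmissible.exists_map_parameters hp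
  obtain ⟨e, he⟩ := exists_ringEquiv_localization hr
  refine ⟨UniversalAdmissible.ring r, integralRing hr, inferInstance, inferInstance,
    inferInstance, UniversalAdmissible.parameters r, integralParameters hr, π, ?_, hp,
    hπ ▸ GroundRing.isMorphism_map, UniversalAdmissible.closure_generators r,
    closure_generators_integralParameters hr, algIndep_integralParameters hr, ?_, ?_, ?_,
    parameters hr, isParameters_parameters hr, isUAdmissible_parameters hr, e,
    he ▸ GroundRing.isMorphism_map⟩
  -- The image of `q - q⁻¹` under `π` is non-zero, so `R₀` is not trivial.
  · refine (UniversalAdmissible.parameters_relations r).isAdmissible (fun h => ?_)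
      (UniversalAdmissible.qDiff_mem_nonZeroDivisors r)
    refine hp.qDiff_ne_zero ?_
    rw [← hπ, GroundRing.map_qDiff, h, map_zero]
  · refine GroundRing.algIndep_of_comp_eq (algebraMap_injective r)
      ((integralRing hr).subtype.comp π) fun i => ?_
    have h : ∀ i : Option (Fin r),
        π (i.elim ((UniversalAdmissible.parameters r).q : UniversalAdmissible.ring r)
            fun i => ((UniversalAdmissible.parameters r).u i : UniversalAdmissible.ring r)) =
          i.elim ((integralParameters hr).q : integralRing hr)
            fun i => ((integralParameters hr).u i : integralRing hr) := fun i => by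
      rw [← hπ]
      cases i <;> rfl
    rw [RingHom.comp_apply, h]
    cases i <;> rfl
  · intro S _ P hP
    obtain ⟨φ, hφ⟩ := UniversalAdmissible.exists_map_parameters hP
    exact ⟨φ, hφ ▸ GroundRing.isMorphism_map⟩
  · intro S _ _ P hP
    -- The map from `R₀` that preserves all parameters exactly factors through `R₊` only if they are
    -- normalized, so `φ` is defined as `ψ.comp π`, with `ψ` built from the twisted parameters.
    obtain ⟨P', hP', hn, hmor⟩ := hP.exists_isNormalized
    obtain ⟨ψ, hψ⟩ := exists_map_integralParameters hr hP' hn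
    have hψP := hmor _ _ ψ hψ
    exact ⟨ψ.comp π, ψ, hψP.comp_map hπ, hψP, rfl⟩
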